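/- Let $\mathcal H$ be a finite dimensional complex Hilbert space, $\mathcal U(\mathcal H)$ its unitary group, $\mathfrak u(\mathcal H)$ the real Lie algebra of skew-Hermitian operators, and $\hbar>0$. An invertible operator $\psi$ on $\mathcal H$ with $\operatorname{Tr}(\psi^\dagger\psi)=1$ is said to purify the invertible density operator $\rho$ if $\psi\psi^\dagger=\rho$. For an operator $\psi$ let $\mathbf J(\psi)\in\mathfrak u(\mathcal H)^*$ be given by $\mathbf J(\psi)\xi=i\hbar\operatorname{Tr}(\psi^\dagger\psi\,\xi)$. Let $$\mathcal S(\psi)=\{\phi \text{ an invertible operator on } \mathcal H:\ \mathbf J(\phi)=\mathbf J(\psi)\},\qquad \mathcal D(\rho)=\{U\rho U^\dagger:\ U\in\mathcal U(\mathcal H)\},$$ and let $\mathcal U(\psi)$ be the group of all $U\in\mathcal U(\mathcal H)$ with $\mathbf J(\psi)(U\xi U^\dagger)=\mathbf J(\psi)(\xi)$ for all $\xi\in\mathfrak u(\mathcal H)$; it acts on $\mathcal S(\psi)$ from the right by $(\phi,U)\mapsto\phi U$. Proposition. Suppose that $\psi$ purifies $\rho$. Then: (1) $\mathcal U(\psi)$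 is the group of all unitary operators $U$ on $\mathcal H$ that commute with $\psi^\dagger\psi$. (2) $\mathcal S(\psi)$, $\mathcal U(\psi)$ and $\mathcal D(\rho)$ are smooth embedded submanifolds of the real vector space of operators on $\mathcal H$, and the coset space $\mathcal S(\psi)/\mathcal U(\psi)$, with the quotient topology, has a smooth manifold structure for which the quotient map $\phi\mapsto[\phi]$ is a smooth submersion. (3) For every choice of smooth structures as in (2), $\phi\phi^\dagger\in\mathcal D(\rho)$ for all $\phi\in\mathcal S(\psi)$, and $[\phi]\mapsto\phi\phi^\dagger$ is a well-defined diffeomorphism from $\mathcal S(\psi)/\mathcal U(\psi)$ onto $\mathcal D(\rho)$. Moreover, $\mathcal U(\psi)$ is a Lie group, and $\mathcal S(\psi)\to\mathcal D(\rho)$, $\phi\mapsto\phi\phi^\dagger$, is a smooth principal fiber bundle with right acting structure group $\mathcal U(\psi)$: the map and the action are smooth, the map is surjective, the action is free, the fibers are exactly the orbits, and around each point of $\mathcal D(\rho)$ there are smooth $\mathcal U(\psi)$-equivariant local trivializations. -/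

import Mathlib

open scoped Manifold ContDiff

noncomputable section

namespace Purification

/-! ### Operators on a finite dimensional Hilbert space

Operators are continuous linear maps `H →L[ℂ] H`; `star` is the Hilbert space adjoint and
`unitary (H →L[ℂ] H)` is the unitary group. Topology and smooth structure of the operator space are
those of a finite dimensional real normed space, so they do not depend on the norm that is used. -/

/-- The trace of an operator. -/
def tr {H : Type*} [NormedAddCommGroup H] [InnerProductSpace ℂ H] (A : H →L[ℂ] H) : ℂ :=
  LinearMap.trace ℂ H (A : H →ₗ[ℂ] H)

theorem tr_mul_comm {H : Type*} [NormedAddCommGroup H] [InnerProductSpace ℂ H]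
    (A B : H →L[ℂ] H) : tr (A * B) = tr (B * A) :=
  LinearMap.trace_mul_comm ℂ (A : H →ₗ[ℂ] H) (B : H →ₗ[ℂ] H)

theorem tr_add {H : Type*} [NormedAddCommGroup H] [InnerProductSpace ℂ H]
    (A B : H →L[ℂ] H) : tr (A + B) = tr A + tr B := by
  simp [tr]

theorem tr_real_smul {H : Type*} [NormedAddCommGroup H] [InnerProductSpace ℂ H]
    (c : ℝ) (A : H →L[ℂ] H) : tr (c • A) = (c : ℂ) * tr A := by
  have h : (c • A : H →L[ℂ] H) = (c : ℂ) • A := rfl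
  rw [h]
  simp [tr]

/-- The invertible density operators: positive, of trace one, invertible. -/
def invertibleDensityOperators (H : Type*) [NormedAddCommGroup H] [InnerProductSpace ℂ H] :
    Set (H →L[ℂ] H) :=
  {ρ | ρ.IsPositive ∧ tr ρ = 1 ∧ IsUnit ρ}

/-- The purifications: invertible operators of Hilbert-Schmidt norm one. -/
def purifications (H : Type*) [NormedAddCommGroup H] [InnerProductSpace ℂ H] [CompleteSpace H] :
    Set (H →L[ℂ] H) :=
  {ψ | IsUnit ψ ∧ tr (star ψ * ψ) = 1}

/-- The projection `ψ ↦ ψ ψ†` of the standard purification bundle. -/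
def proj {H : Type*} [NormedAddCommGroup H] [InnerProductSpace ℂ H] [CompleteSpace H]
    (ψ : H →L[ℂ] H) : H →L[ℂ] H :=
  ψ * star ψ

/-- `ψ` purifies the invertible density operator `ρ`. -/
def Purifies {H : Type*} [NormedAddCommGroup H] [InnerProductSpace ℂ H] [CompleteSpace H]
    (ψ ρ : H →L[ℂ] H) : Prop :=
  ρ ∈ invertibleDensityOperators H ∧ ψ ∈ purifications H ∧ proj ψ = ρ

/-- The isospectral orbit of `ρ`: the operators `U ρ U†` with `U` unitary. -/
def isospectralOrbit {H : Type*} [NormedAddCommGroup H] [InnerProductSpace ℂ H] [CompleteSpace H]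
    (ρ : H →L[ℂ] H) : Set (H →L[ℂ] H) :=
  {σ | ∃ U : unitary (H →L[ℂ] H), σ = (U : H →L[ℂ] H) * ρ * star (U : H →L[ℂ] H)}

/-! ### The momentum map -/

/-- The Lie algebra of the unitary group: the skew-Hermitian operators. -/
abbrev LieAlg (H : Type*) [NormedAddCommGroup H] [InnerProductSpace ℂ H] [CompleteSpace H] :
    Type _ :=
  skewAdjoint (H →L[ℂ] H)

/-- The adjoint representation `ξ ↦ U ξ U†`. -/
def Ad {H : Type*} [NormedAddCommGroup H] [InnerProductSpace ℂ H] [CompleteSpace H]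
    (U : unitary (H →L[ℂ] H)) : LieAlg H →ₗ[ℝ] LieAlg H where
  toFun ξ := ⟨(U : H →L[ℂ] H) * ξ * star (U : H →L[ℂ] H), skewAdjoint.conjugate ξ.2 _⟩
  map_add' ξ η := by
    ext1
    simp [mul_add, add_mul]
  map_smul' c ξ := by
    ext1
    simp

/-- The right coadjoint action `μ ↦ μ ∘ Ad U`. -/
def coAd {H : Type*} [NormedAddCommGroup H] [InnerProductSpace ℂ H] [CompleteSpace H]
    (U : unitary (H →L[ℂ] H)) (μ : LieAlg H →ₗ[ℝ] ℝ) : LieAlg H →ₗ[ℝ] ℝ :=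
  μ ∘ₗ Ad U

/-- The momentum map, `J ħ ψ ξ = i ħ Tr(ψ† ψ ξ)`. This trace expression is real, see
`ofReal_J_apply`, so taking its real part only serves to land in `ℝ`. -/
def J {H : Type*} [NormedAddCommGroup H] [InnerProductSpace ℂ H] [CompleteSpace H]
    (ħ : ℝ) (ψ : H →L[ℂ] H) : LieAlg H →ₗ[ℝ] ℝ where
  toFun ξ := (Complex.I * ħ * tr (star ψ * ψ * (ξ : H →L[ℂ] H))).re
  map_add' ξ η := by
    simp only [AddSubgroup.coe_add, mul_add, tr_add, Complex.add_re]
  map_smul' c ξ := by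
    simp only [skewAdjoint.val_smul, mul_smul_comm, tr_real_smul, RingHom.id_apply, smul_eq_mul]
    rw [mul_left_comm, Complex.re_ofReal_mul]

theorem tr_star {H : Type*} [NormedAddCommGroup H] [InnerProductSpace ℂ H] [CompleteSpace H]
    [FiniteDimensional ℂ H] (A : H →L[ℂ] H) : tr (star A) = star (tr A) := by
  have b := stdOrthonormalBasis ℂ H
  unfold tr
  rw [LinearMap.trace_eq_sum_inner _ b, LinearMap.trace_eq_sum_inner _ b, star_sum]
  refine Finset.sum_congr rfl fun i _ => ?_
  simp [ContinuousLinearMap.star_eq_adjoint, ContinuousLinearMap.adjoint_inner_right]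

theorem ofReal_J_apply {H : Type*} [NormedAddCommGroup H] [InnerProductSpace ℂ H] [CompleteSpace H]
    [FiniteDimensional ℂ H] (ħ : ℝ) (ψ : H →L[ℂ] H) (ξ : LieAlg H) :
    ((J ħ ψ ξ : ℝ) : ℂ) = Complex.I * ħ * tr (star ψ * ψ * (ξ : H →L[ℂ] H)) := by
  have h : star (tr (star ψ * ψ * (ξ : H →L[ℂ] H))) = - tr (star ψ * ψ * (ξ : H →L[ℂ] H)) := by
    rw [← tr_star, star_mul, star_mul, star_star, skewAdjoint.mem_iff.mp ξ.2, tr_mul_comm]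
    simp [tr]
  refine Complex.conj_eq_iff_re.mp ?_
  rw [map_mul, map_mul, Complex.conj_I, Complex.conj_ofReal]
  rw [show (starRingEnd ℂ) (tr (star ψ * ψ * (ξ : H →L[ℂ] H))) = _ from h]
  ring

theorem coAd_one {H : Type*} [NormedAddCommGroup H] [InnerProductSpace ℂ H] [CompleteSpace H]
    (μ : LieAlg H →ₗ[ℝ] ℝ) : coAd 1 μ = μ := by
  ext ξ
  simp [coAd, Ad]

theorem coAd_mul {H : Type*} [NormedAddCommGroup H] [InnerProductSpace ℂ H] [CompleteSpace H]
    (U V : unitary (H →L[ℂ] H)) (μ : LieAlg H →ₗ[ℝ] ℝ) :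
    coAd (U * V) μ = coAd V (coAd U μ) := by
  ext ξ
  simp [coAd, Ad, mul_assoc]

theorem J_mul_unitary {H : Type*} [NormedAddCommGroup H] [InnerProductSpace ℂ H] [CompleteSpace H]
    (ħ : ℝ) (φ : H →L[ℂ] H) (U : unitary (H →L[ℂ] H)) :
    J ħ (φ * (U : H →L[ℂ] H)) = coAd U (J ħ φ) := by
  ext ξ
  have h : tr (star (φ * (U : H →L[ℂ] H)) * (φ * (U : H →L[ℂ] H)) * (ξ : H →L[ℂ] H))
      = tr (star φ * φ * ((U : H →L[ℂ] H) * (ξ : H →L[ℂ] H) * star (U : H →L[ℂ] H))) := by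
    rw [star_mul, mul_assoc, mul_assoc, tr_mul_comm]
    simp only [mul_assoc]
  simp only [J, coAd, Ad, LinearMap.coe_mk, AddHom.coe_mk, LinearMap.comp_apply, h]

/-- The level set `S(ψ)` of the momentum map, which lives on the invertible operators. -/
def levelSet {H : Type*} [NormedAddCommGroup H] [InnerProductSpace ℂ H] [CompleteSpace H]
    (ħ : ℝ) (ψ : H →L[ℂ] H) : Set (H →L[ℂ] H) :=
  {φ | IsUnit φ ∧ J ħ φ = J ħ ψ}

/-- The isotropy group `U(ψ)` of `J ħ ψ` under the right coadjoint action. -/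
def isotropyGroup {H : Type*} [NormedAddCommGroup H] [InnerProductSpace ℂ H] [CompleteSpace H]
    (ħ : ℝ) (ψ : H →L[ℂ] H) : Subgroup (unitary (H →L[ℂ] H)) where
  carrier := {U | coAd U (J ħ ψ) = J ħ ψ}
  one_mem' := coAd_one _
  mul_mem' {U V} hU hV := by
    simp only [Set.mem_ofPred_eq] at hU hV ⊢
    rw [coAd_mul, hU, hV]
  inv_mem' {U} hU := by
    simp only [Set.mem_ofPred_eq] at hU ⊢
    conv_lhs => rw [← hU]
    rw [← coAd_mul, mul_inv_cancel, coAd_one]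

/-- The right action `(φ, U) ↦ φ U` of `U(ψ)` on `S(ψ)`, as an action of the opposite group. -/
instance rightAction {H : Type*} [NormedAddCommGroup H] [InnerProductSpace ℂ H] [CompleteSpace H]
    (ħ : ℝ) (ψ : H →L[ℂ] H) : MulAction (isotropyGroup ħ ψ)ᵐᵒᵖ (levelSet ħ ψ) where
  smul U φ := ⟨(φ : H →L[ℂ] H) * ((U.unop : unitary (H →L[ℂ] H)) : H →L[ℂ] H), by
    refine ⟨φ.2.1.mul (Unitary.toUnits (U.unop : unitary (H →L[ℂ] H))).isUnit, ?_⟩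
    rw [J_mul_unitary, φ.2.2]
    exact U.unop.2⟩
  one_smul φ := Subtype.ext (mul_one _)
  mul_smul U V φ := Subtype.ext (mul_assoc _ _ _).symm

/-- The coset space `S(ψ)/U(ψ)`, which carries the quotient topology. -/
abbrev cosetSpace {H : Type*} [NormedAddCommGroup H] [InnerProductSpace ℂ H] [CompleteSpace H]
    (ħ : ℝ) (ψ : H →L[ℂ] H) : Type _ :=
  MulAction.orbitRel.Quotient (isotropyGroup ħ ψ)ᵐᵒᵖ (levelSet ħ ψ)

/-- The quotient map `φ ↦ [φ]`. -/
def cosetMk {H : Type*} [NormedAddCommGroup H] [InnerProductSpace ℂ H] [CompleteSpace H]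
    (ħ : ℝ) (ψ : H →L[ℂ] H) (φ : levelSet ħ ψ) : cosetSpace ħ ψ :=
  Quotient.mk (MulAction.orbitRel (isotropyGroup ħ ψ)ᵐᵒᵖ (levelSet ħ ψ)) φ

/-- The inclusion of `U(ψ)` into the operator space. -/
def isotropyIncl {H : Type*} [NormedAddCommGroup H] [InnerProductSpace ℂ H] [CompleteSpace H]
    (ħ : ℝ) (ψ : H →L[ℂ] H) (U : isotropyGroup ħ ψ) : H →L[ℂ] H :=
  ((U : unitary (H →L[ℂ] H)) : H →L[ℂ] H)

/-! ### The manifold structures -/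

/-- The given atlases on `S(ψ)`, `U(ψ)`, `D(ρ)` and `S(ψ)/U(ψ)` (compatible with the topologies
that these spaces have as subspaces and as a quotient) are the standard smooth structures: the
first three are embedded submanifolds of the real vector space of operators on `H`, and the last
one is the quotient manifold, that is, the quotient map is a smooth submersion. These properties
determine the smooth structures. -/
structure IsStandardSmoothStructure {H : Type*} [NormedAddCommGroup H] [InnerProductSpace ℂ H]
    [CompleteSpace H] (ħ : ℝ) (ψ ρ : H →L[ℂ] H) (s g d q : ℕ)
    [ChartedSpace (EuclideanSpace ℝ (Fin s)) (levelSet ħ ψ)]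
    [ChartedSpace (EuclideanSpace ℝ (Fin g)) (isotropyGroup ħ ψ)]
    [ChartedSpace (EuclideanSpace ℝ (Fin d)) (isospectralOrbit ρ)]
    [ChartedSpace (EuclideanSpace ℝ (Fin q)) (cosetSpace ħ ψ)] : Prop where
  isManifold_levelSet : IsManifold (𝓡 s) ∞ (levelSet ħ ψ)
  isManifold_isotropyGroup : IsManifold (𝓡 g) ∞ (isotropyGroup ħ ψ)
  isManifold_isospectralOrbit : IsManifold (𝓡 d) ∞ (isospectralOrbit ρ)
  isManifold_cosetSpace : IsManifold (𝓡 q) ∞ (cosetSpace ħ ψ)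
  embedding_levelSet : Manifold.IsSmoothEmbedding (𝓡 s) 𝓘(ℝ, H →L[ℂ] H) ∞
    (Subtype.val : levelSet ħ ψ → H →L[ℂ] H)
  embedding_isotropyGroup : Manifold.IsSmoothEmbedding (𝓡 g) 𝓘(ℝ, H →L[ℂ] H) ∞
    (isotropyIncl ħ ψ)
  embedding_isospectralOrbit : Manifold.IsSmoothEmbedding (𝓡 d) 𝓘(ℝ, H →L[ℂ] H) ∞
    (Subtype.val : isospectralOrbit ρ → H →L[ℂ] H)
  submersion_cosetMk : Manifold.IsSubmersion (𝓡 s) (𝓡 q) ∞ (cosetMk ħ ψ)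

/-- `π : P → M` is a smooth principal fiber bundle whose structure group is the Lie group `G`,
acting on `P` from the right (`MulOpposite.op a • p` is `p a`). -/
structure IsPrincipalBundle {EP EM EG : Type*}
    [NormedAddCommGroup EP] [NormedSpace ℝ EP] [NormedAddCommGroup EM] [NormedSpace ℝ EM]
    [NormedAddCommGroup EG] [NormedSpace ℝ EG] {HP HM HG : Type*} [TopologicalSpace HP]
    [TopologicalSpace HM] [TopologicalSpace HG]
    (IP : ModelWithCorners ℝ EP HP) (IM : ModelWithCorners ℝ EM HM) (IG : ModelWithCorners ℝ EG HG)
    {P M : Type*} (G : Type*) [TopologicalSpace P] [TopologicalSpace M] [TopologicalSpace G]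
    [ChartedSpace HP P] [ChartedSpace HM M] [ChartedSpace HG G]
    [Group G] [MulAction Gᵐᵒᵖ P] (π : P → M) : Prop where
  isManifold_total : IsManifold IP ∞ P
  isManifold_base : IsManifold IM ∞ M
  lieGroup : LieGroup IG ∞ G
  contMDiff_action : ContMDiff (IP.prod IG) IP ∞ (fun x : P × G => MulOpposite.op x.2 • x.1)
  contMDiff_proj : ContMDiff IP IM ∞ π
  free : ∀ (p : P) (a : G), MulOpposite.op a • p = p → a = 1
  surjective : Function.Surjective π
  fiber : ∀ p p' : P, π p = π p' ↔ ∃ a : G, p' = MulOpposite.op a • p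
  /-- Around each point there is a smooth equivariant trivialization
  `π⁻¹(V) ≅ V × G`, `p ↦ (π(p), τ(p))` with `τ(p a) = τ(p) a`. -/
  locallyTrivial : ∀ x : M, ∃ e : Bundle.Trivialization G π, x ∈ e.baseSet ∧
    ContMDiffOn IP (IM.prod IG) ∞ e e.source ∧
    ContMDiffOn (IM.prod IG) IP ∞ e.toOpenPartialHomeomorph.symm e.target ∧
    ∀ p ∈ e.source, ∀ a : G, (e (MulOpposite.op a • p)).2 = (e p).2 * a

end Purification

end

namespace Purification

open Topology Set Filter

/-! The trace form separates Hermitian operators, so `J φ = J ψ` amounts to `φ†φ = P` with `P = ψ†ψ`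
(`J_eq_J_iff`). Hence `S(ψ)` is the orbit `U(H)ψ`, `U(ψ)` is the unitary part of the commutant of
`P`, and two points of `S(ψ)` with equal `φφ†` differ by the element `φ⁻¹φ'` of `U(ψ)`.

All three spaces are homogeneous under ambient linear maps, so each is an embedded submanifold as
soon as it is an analytic retract near one point (`exists_smoothEmbedding_of_retraction`). The
retractions come from the unitary part `Q w = w (w†w)^(-1/2)`, analytic near `1` and compatible with
intertwining relations (`exists_unitary_part`). For `S(ψ)` it is `Q (y ψ⁻¹) ψ`; for `U(ψ)`, `Q` of
the block diagonal part of `y`; for `D(ρ)`, `U y ρ (U y)†`, where `U y = Q (∑ p_a(y) p_a(ρ))` and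
the `p_a` produce spectral projections.

The same `U` gives the local sections `σ ↦ U σ ψ` of `φ ↦ φφ†`, and thus local trivializations.
Since `S(ψ)` is compact, the coset space is embedded with image `D(ρ)`. The bundle theorem holds for
any embedded copy of the orbit; applied to the coset space it yields the submersion, applied to
`D(ρ)` the bundle. For arbitrary structures as in (2), smoothness into an embedded submanifold is
tested in the ambient space and smoothness out of the coset space is tested on `S(ψ)`. -/

/-! ### Slice charts of submanifolds of a finite dimensional vector space -/

/-- A chart of the ambient space which straightens `M` to `V × {0}`. -/
structure IsSliceChart {E V F : Type*} [NormedAddCommGroup E] [NormedSpace ℝ E]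
    [NormedAddCommGroup V] [NormedSpace ℝ V] [NormedAddCommGroup F] [NormedSpace ℝ F]
    (M : Set E) (Ψ : OpenPartialHomeomorph E (V × F)) : Prop where
  contDiffOn : ContDiffOn ℝ ∞ Ψ Ψ.source
  contDiffOn_symm : ContDiffOn ℝ ∞ Ψ.symm Ψ.target
  mem_iff : ∀ y ∈ Ψ.source, y ∈ M ↔ (Ψ y).2 = 0

/-- This is the splitting `E = im P ⊕ ker P`, with the image identified with a Euclidean space so
that it can serve as a chart model. -/
theorem exists_prod_equiv_of_idempotent {E : Type*} [NormedAddCommGroup E] [NormedSpace ℝ E]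
    [FiniteDimensional ℝ E] (P : E →L[ℝ] E) (hP : ∀ x, P (P x) = P x) :
    ∃ (n : ℕ) (F : Submodule ℝ E) (L : (EuclideanSpace ℝ (Fin n) × F) ≃L[ℝ] E),
      ∀ z, P (L z) = L (z.1, 0) := by
  have hid : IsIdempotentElem (P : E →ₗ[ℝ] E) := LinearMap.ext hP
  set K := LinearMap.range (P : E →ₗ[ℝ] E)
  set F := LinearMap.ker (P : E →ₗ[ℝ] E)
  have hc : IsCompl K F := LinearMap.IsIdempotentElem.isCompl hid
  have hK : Module.finrank ℝ (EuclideanSpace ℝ (Fin (Module.finrank ℝ K)))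
      = Module.finrank ℝ K := finrank_euclideanSpace_fin
  let e := ContinuousLinearEquiv.ofFinrankEq hK
  let L := (e.prodCongr (ContinuousLinearEquiv.refl ℝ F)).trans
    (Submodule.prodEquivOfIsCompl K F hc).toContinuousLinearEquiv
  have hL : ∀ z, L z = (e z.1 : E) + z.2 := fun z => by simp [L]
  refine ⟨_, F, L, fun z => ?_⟩
  have h1 : P (e z.1) = e z.1 := by
    obtain ⟨x, hx⟩ := (e z.1).2
    rw [← hx]
    exact hP x
  have h2 : P z.2 = 0 := z.2.2
  rw [hL, hL, map_add, h1, h2]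
  simp

/-- Differentiating `r ∘ r = r` shows that `P = Dr(x₀)` is idempotent. The map `P (r y - x₀) + (1 -
P)(y - r y)` has derivative `P + (1 - P) = 1` at `x₀` and conjugates `r` to the projection onto `im
P`. Near `x₀` the set is the fixed point set of `r`, so it becomes the slice. -/
theorem exists_sliceChart_of_retraction {E : Type*} [NormedAddCommGroup E] [NormedSpace ℝ E]
    [FiniteDimensional ℝ E] {M : Set E} {x₀ : E} (hx₀ : x₀ ∈ M) {r : E → E}
    (hr : ContDiffAt ℝ ω r x₀) (hrM : ∀ᶠ y in 𝓝 x₀, r y ∈ M)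
    (hid : ∀ᶠ y in 𝓝 x₀, y ∈ M → r y = y) :
    ∃ (n : ℕ) (F : Submodule ℝ E)
      (Ψ : OpenPartialHomeomorph E (EuclideanSpace ℝ (Fin n) × F)),
      x₀ ∈ Ψ.source ∧ IsSliceChart M Ψ := by
  have : CompleteSpace E := FiniteDimensional.complete ℝ E
  have hω : (ω : WithTop ℕ∞) ≠ 0 := by simp
  have hfix : r x₀ = x₀ := hid.self_of_nhds hx₀
  have hrr : ∀ᶠ y in 𝓝 x₀, r (r y) = r y := by
    have h1 : ∀ᶠ y in 𝓝 x₀, r y ∈ M → r (r y) = r y := by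
      have h0 : Tendsto r (𝓝 x₀) (𝓝 x₀) := by
        simpa only [ContinuousAt, hfix] using hr.continuousAt
      exact h0.eventually hid
    filter_upwards [h1, hrM] with y h1 h2 using h1 h2
  set P := fderiv ℝ r x₀ with hPdef
  have hdr : HasFDerivAt r P x₀ := (hr.differentiableAt hω).hasFDerivAt
  have hPP : P.comp P = P := by
    have h1 : HasFDerivAt (r ∘ r) (P.comp P) x₀ := by
      refine HasFDerivAt.comp x₀ ?_ hdr
      rwa [hfix]
    exact h1.unique (hdr.congr_of_eventuallyEq hrr)
  obtain ⟨n, F, L, hL⟩ := exists_prod_equiv_of_idempotent P fun x => DFunLike.congr_fun hPP x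
  let Θ : E → EuclideanSpace ℝ (Fin n) × F := fun y =>
    L.symm (P (r y - x₀) + ((y - r y) - P (y - r y)))
  have hΘd : HasFDerivAt Θ (L.symm : E →L[ℝ] EuclideanSpace ℝ (Fin n) × F) x₀ := by
    have h1 : HasFDerivAt (fun y => y - r y) (ContinuousLinearMap.id ℝ E - P) x₀ :=
      (hasFDerivAt_id x₀).sub hdr
    have h2 := (P.hasFDerivAt.comp x₀ (hdr.sub_const x₀)).add
      (h1.sub (P.hasFDerivAt.comp x₀ h1))
    have h3 := (L.symm : E →L[ℝ] EuclideanSpace ℝ (Fin n) × F).hasFDerivAt.comp x₀ h2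
    refine h3.congr_fderiv ?_
    rw [ContinuousLinearMap.comp_sub, hPP, ContinuousLinearMap.comp_id]
    ext1 v
    simp
  have hΘ : ∀ y, ContDiffAt ℝ ω r y → ContDiffAt ℝ ω Θ y := fun y hy => by
    refine L.symm.contDiff.contDiffAt.comp y ?_
    have h1 : ContDiffAt ℝ ω (fun y => y - r y) y := contDiffAt_id.sub hy
    exact (P.contDiff.contDiffAt.comp y (hy.sub contDiffAt_const)).add
      (h1.sub (P.contDiff.contDiffAt.comp y h1))
  have hconj : ∀ y, r (r y) = r y → Θ (r y) = ((Θ y).1, 0) := fun y hy => by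
    apply L.injective
    rw [← hL]
    simp only [Θ, hy, sub_self, add_zero, L.apply_symm_apply, map_add, map_sub]
    have h (x) : P (P x) = P x := DFunLike.congr_fun hPP x
    simp [h]
  let Ψ₁ := (hΘ x₀ hr).toOpenPartialHomeomorph Θ hΘd hω
  have hΨ₁ : (Ψ₁ : E → _) = Θ := rfl
  have hx₁ : x₀ ∈ Ψ₁.source := ContDiffAt.mem_toOpenPartialHomeomorph_source (hΘ x₀ hr) hΘd hω
  have hsymm : ContDiffAt ℝ ω Ψ₁.symm (Ψ₁ x₀) := by
    refine Ψ₁.contDiffAt_symm (Ψ₁.map_source hx₁) (f₀' := L.symm) ?_ ?_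
    · rw [Ψ₁.left_inv hx₁]; exact hΘd
    · rw [Ψ₁.left_inv hx₁]; exact hΘ x₀ hr
  -- Regularity `ω` at a point spreads to a neighbourhood, whereas `ContDiffAt ℝ ∞` need not; this
  -- is why `r` is taken analytic.
  have hev : ∀ᶠ y in 𝓝 x₀, y ∈ Ψ₁.source ∧ ContDiffAt ℝ ω r y ∧ r y ∈ M ∧ (y ∈ M → r y = y) ∧
      r (r y) = r y ∧ ContDiffAt ℝ ω Ψ₁.symm (Ψ₁ y) := by
    filter_upwards [Ψ₁.open_source.mem_nhds hx₁, hr.eventually (by simp), hrM, hid, hrr,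
      (Ψ₁.continuousAt hx₁).eventually (hsymm.eventually (by simp))] with y h1 h2 h3 h4 h5 h6
    exact ⟨h1, h2, h3, h4, h5, h6⟩
  obtain ⟨O, hO, hOo, hxO⟩ := eventually_nhds_iff.1 hev
  have hcont : ContinuousOn r O := fun y hy => (hO y hy).2.1.continuousAt.continuousWithinAt
  -- Both `y` and `r y` must lie where `Ψ₁` is injective, in order to deduce `r y = y` from equal
  -- images.
  have hSo : IsOpen (O ∩ r ⁻¹' O) := hcont.isOpen_inter_preimage hOo hOo
  have hsource : ∀ y, y ∈ (Ψ₁.restrOpen _ hSo).source ↔ y ∈ O ∧ r y ∈ O := fun y => by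
    rw [OpenPartialHomeomorph.restrOpen_source]
    exact ⟨fun h => h.2, fun h => ⟨(hO y h.1).1, h⟩⟩
  refine ⟨n, F, Ψ₁.restrOpen _ hSo, (hsource _).2 ⟨hxO, by rwa [hfix]⟩, ?_, ?_, ?_⟩
  · intro y hy
    exact ((hΘ y (hO y ((hsource y).1 hy).1).2.1).of_le le_top).contDiffWithinAt
  · intro z hz
    have h1 := (Ψ₁.restrOpen _ hSo).map_target hz
    have h2 := (hO _ ((hsource _).1 h1).1).2.2.2.2.2
    have h3 : Ψ₁ ((Ψ₁.restrOpen _ hSo).symm z) = z := (Ψ₁.restrOpen _ hSo).right_inv hz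
    rw [h3] at h2
    exact (h2.of_le le_top).contDiffWithinAt
  · intro y hy
    obtain ⟨hy1, hy2⟩ := (hsource y).1 hy
    obtain ⟨hys, -, hyM, hyid, hyr, -⟩ := hO y hy1
    change y ∈ M ↔ (Θ y).2 = 0
    constructor
    · intro h
      have h2 := hconj y hyr
      rw [hyid h] at h2
      rw [h2]
    · intro h
      have h2 : Ψ₁ (r y) = Ψ₁ y := by
        change Θ (r y) = Θ y
        rw [hconj y hyr]
        exact Prod.ext rfl h.symm
      rw [← Ψ₁.injOn (hO _ hy2).1 hys h2]
      exact hyM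

theorem IsSliceChart.precomp {E V F : Type*} [NormedAddCommGroup E] [NormedSpace ℝ E]
    [NormedAddCommGroup V] [NormedSpace ℝ V] [NormedAddCommGroup F] [NormedSpace ℝ F]
    {M : Set E} {Ψ : OpenPartialHomeomorph E (V × F)} (h : IsSliceChart M Ψ)
    (T : E ≃L[ℝ] E) (hT : ∀ y, T y ∈ M ↔ y ∈ M) :
    IsSliceChart M (T.toHomeomorph.transOpenPartialHomeomorph Ψ) where
  contDiffOn := h.contDiffOn.comp T.contDiff.contDiffOn fun _ hy => hy
  contDiffOn_symm := T.symm.contDiff.comp_contDiffOn h.contDiffOn_symm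
  mem_iff y hy := by
    rw [← hT]
    exact h.mem_iff (T y) hy

/-- The chart of an embedded submanifold that a slice chart of the ambient space induces. -/
noncomputable def IsSliceChart.chart {E V F M : Type*} [NormedAddCommGroup E] [NormedSpace ℝ E]
    [NormedAddCommGroup V] [NormedSpace ℝ V] [NormedAddCommGroup F] [NormedSpace ℝ F]
    [TopologicalSpace M] {ι : M → E} (hι : IsEmbedding ι) [Nonempty M]
    {Ψ : OpenPartialHomeomorph E (V × F)} (h : IsSliceChart (range ι) Ψ) :
    OpenPartialHomeomorph M V where
  toFun m := (Ψ (ι m)).1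
  -- The arbitrary values of `Function.invFun` play no role: on the target, `Ψ.symm (u, 0)` lies in
  -- the range of `ι`.
  invFun u := Function.invFun ι (Ψ.symm (u, 0))
  source := ι ⁻¹' Ψ.source
  target := (fun u => (u, 0)) ⁻¹' Ψ.target
  map_source' m hm := by
    have h2 := (h.mem_iff _ hm).1 ⟨m, rfl⟩
    have h3 := Ψ.map_source hm
    rwa [← Prod.mk.eta (p := Ψ (ι m)), h2] at h3
  map_target' u hu := by
    have h1 : ι (Function.invFun ι (Ψ.symm (u, 0))) = Ψ.symm (u, 0) :=
      Function.invFun_eq ((h.mem_iff _ (Ψ.map_target hu)).2 (by rw [Ψ.right_inv hu]))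
    rw [mem_preimage, h1]
    exact Ψ.map_target hu
  left_inv' m hm := by
    have h2 := (h.mem_iff _ hm).1 ⟨m, rfl⟩
    have h3 : ((Ψ (ι m)).1, (0 : F)) = Ψ (ι m) := Prod.ext rfl h2.symm
    rw [h3, Ψ.left_inv hm]
    exact Function.leftInverse_invFun hι.injective m
  right_inv' u hu := by
    have h1 : ι (Function.invFun ι (Ψ.symm (u, 0))) = Ψ.symm (u, 0) :=
      Function.invFun_eq ((h.mem_iff _ (Ψ.map_target hu)).2 (by rw [Ψ.right_inv hu]))
    rw [h1, Ψ.right_inv hu]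
  open_source := Ψ.open_source.preimage hι.continuous
  open_target := Ψ.open_target.preimage (by fun_prop)
  continuousOn_toFun := continuous_fst.comp_continuousOn
    (Ψ.continuousOn.comp hι.continuous.continuousOn fun _ hm => hm)
  continuousOn_invFun := by
    rw [hι.continuousOn_iff]
    refine (Ψ.continuousOn_symm.comp (f := fun u : V => (u, (0 : F))) (by fun_prop)
      fun _ hu => hu).congr fun u hu => ?_
    exact Function.invFun_eq ((h.mem_iff _ (Ψ.map_target hu)).2 (by rw [Ψ.right_inv hu]))

theorem IsSliceChart.incl_chart_symm {E V F M : Type*} [NormedAddCommGroup E] [NormedSpace ℝ E]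
    [NormedAddCommGroup V] [NormedSpace ℝ V] [NormedAddCommGroup F] [NormedSpace ℝ F]
    [TopologicalSpace M] {ι : M → E} (hι : IsEmbedding ι) [Nonempty M]
    {Ψ : OpenPartialHomeomorph E (V × F)} (h : IsSliceChart (range ι) Ψ) {u : V}
    (hu : u ∈ (h.chart hι).target) : ι ((h.chart hι).symm u) = Ψ.symm (u, 0) :=
  Function.invFun_eq ((h.mem_iff _ (Ψ.map_target hu)).2 (by rw [Ψ.right_inv hu]))

/-- A space that is embedded in a vector space such that slice charts exist around every point is an
embedded submanifold. -/
theorem exists_smoothEmbedding_of_sliceCharts {E V F M : Type*} [NormedAddCommGroup E]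
    [NormedSpace ℝ E] [NormedAddCommGroup V] [NormedSpace ℝ V] [NormedAddCommGroup F]
    [NormedSpace ℝ F] [TopologicalSpace M] {ι : M → E} (hι : IsEmbedding ι)
    (L : (V × F) ≃L[ℝ] E) (Ψ : M → OpenPartialHomeomorph E (V × F))
    (hΨ : ∀ m, IsSliceChart (range ι) (Ψ m)) (hmem : ∀ m, ι m ∈ (Ψ m).source) :
    ∃ _ : ChartedSpace V M, IsManifold 𝓘(ℝ, V) ∞ M ∧
      Manifold.IsSmoothEmbedding 𝓘(ℝ, V) 𝓘(ℝ, E) ∞ ι := by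
  have hne (m : M) : Nonempty M := ⟨m⟩
  let c : M → OpenPartialHomeomorph M V := fun m =>
    haveI := hne m
    (hΨ m).chart hι
  let cs : ChartedSpace V M :=
    { atlas := range c
      chartAt := c
      mem_chart_source := hmem
      chart_mem_atlas := fun m => ⟨m, rfl⟩ }
  have hman : IsManifold 𝓘(ℝ, V) ∞ M := by
    refine isManifold_of_contDiffOn _ _ _ ?_
    rintro _ _ ⟨m, rfl⟩ ⟨m', rfl⟩
    have := hne m
    simp only [modelWithCornersSelf_coe, modelWithCornersSelf_coe_symm, Function.id_comp,
      Function.comp_id, preimage_id, range_id, inter_univ]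
    have hs : ∀ u ∈ ((c m).symm ≫ₕ c m').source, u ∈ (c m).target ∧
        (Ψ m).symm (u, 0) ∈ (Ψ m').source := fun u hu => by
      rw [OpenPartialHomeomorph.trans_source] at hu
      refine ⟨hu.1, ?_⟩
      have h2 : ι ((c m).symm u) ∈ (Ψ m').source := hu.2
      rwa [(hΨ m).incl_chart_symm hι hu.1] at h2
    have key : ContDiffOn ℝ ∞ (fun u : V => (Ψ m' ((Ψ m).symm (u, 0))).1)
        ((c m).symm ≫ₕ c m').source := by
      refine contDiff_fst.comp_contDiffOn ((hΨ m').contDiffOn.comp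
        ((hΨ m).contDiffOn_symm.comp (by fun_prop) fun u hu => ?_) fun u hu => ?_)
      · exact (hs u hu).1
      · exact (hs u hu).2
    refine key.congr fun u hu => ?_
    change (Ψ m' (ι ((c m).symm u))).1 = _
    rw [(hΨ m).incl_chart_symm hι (hs u hu).1]
  refine ⟨cs, hman, Manifold.IsImmersionOfComplement.isImmersion (F := F) fun m => ?_, hι⟩
  have := hne m
  -- A chart of `E` has to take values in `E`, so `L` brings `V × F` back.
  have hcod : (Ψ m ≫ₕ L.toHomeomorph.toOpenPartialHomeomorph) ∈
      IsManifold.maximalAtlas 𝓘(ℝ, E) ∞ E := by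
    rw [IsManifold.mem_maximalAtlas_iff_contMDiffOn, contMDiffOn_iff_contDiffOn,
      contMDiffOn_iff_contDiffOn]
    constructor
    · exact L.contDiff.comp_contDiffOn ((hΨ m).contDiffOn.mono fun y hy => hy.1)
    · exact (hΨ m).contDiffOn_symm.comp L.symm.contDiff.contDiffOn fun y hy => hy.2
  refine Manifold.IsImmersionAtOfComplement.mk_of_charts L (c m)
    (Ψ m ≫ₕ L.toHomeomorph.toOpenPartialHomeomorph) (hmem m) ⟨hmem m, trivial⟩
    (IsManifold.chart_mem_maximalAtlas (I := 𝓘(ℝ, V)) m) hcod (fun y hy => ⟨hy, trivial⟩) ?_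
  intro u hu
  have hu' : u ∈ (c m).target := by simpa using hu
  change L (Ψ m (ι ((c m).symm u))) = L (u, 0)
  rw [(hΨ m).incl_chart_symm hι hu', (Ψ m).right_inv hu']

/-- A homogeneous subset that is a smooth retract near one of its points is an embedded
submanifold. -/
theorem exists_smoothEmbedding_of_retraction {E M : Type*} [NormedAddCommGroup E]
    [NormedSpace ℝ E] [FiniteDimensional ℝ E] [TopologicalSpace M] {ι : M → E}
    (hι : IsEmbedding ι) {x₀ : E} (hx₀ : x₀ ∈ range ι) {r : E → E}
    (hr : ContDiffAt ℝ ω r x₀) (hrM : ∀ᶠ y in 𝓝 x₀, r y ∈ range ι)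
    (hid : ∀ᶠ y in 𝓝 x₀, y ∈ range ι → r y = y)
    (hom : ∀ x ∈ range ι, ∃ T : E ≃L[ℝ] E, T x = x₀ ∧ ∀ y, T y ∈ range ι ↔ y ∈ range ι) :
    ∃ (n : ℕ) (_ : ChartedSpace (EuclideanSpace ℝ (Fin n)) M), IsManifold (𝓡 n) ∞ M ∧
      Manifold.IsSmoothEmbedding (𝓡 n) 𝓘(ℝ, E) ∞ ι := by
  obtain ⟨n, F, Ψ, hxΨ, hΨ⟩ := exists_sliceChart_of_retraction hx₀ hr hrM hid
  -- The derivative of `Ψ` at `x₀` is invertible, with inverse the derivative of `Ψ.symm`.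
  obtain ⟨L⟩ : Nonempty ((EuclideanSpace ℝ (Fin n) × F) ≃L[ℝ] E) := by
    have hd : DifferentiableAt ℝ Ψ x₀ :=
      ((hΨ.contDiffOn.contDiffAt (Ψ.open_source.mem_nhds hxΨ)).differentiableAt (by simp))
    have hd' : DifferentiableAt ℝ Ψ.symm (Ψ x₀) :=
      ((hΨ.contDiffOn_symm.contDiffAt
        (Ψ.open_target.mem_nhds (Ψ.map_source hxΨ))).differentiableAt (by simp))
    have h1 : (fderiv ℝ Ψ.symm (Ψ x₀)).comp (fderiv ℝ Ψ x₀) = ContinuousLinearMap.id ℝ E := by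
      refine (hd'.hasFDerivAt.comp x₀ hd.hasFDerivAt).unique
        ((hasFDerivAt_id x₀).congr_of_eventuallyEq (Ψ.eventually_left_inverse hxΨ))
    have h2 : (fderiv ℝ Ψ x₀).comp (fderiv ℝ Ψ.symm (Ψ x₀)) = ContinuousLinearMap.id ℝ _ := by
      have hd2 : HasFDerivAt Ψ (fderiv ℝ Ψ x₀) (Ψ.symm (Ψ x₀)) := by
        rw [Ψ.left_inv hxΨ]; exact hd.hasFDerivAt
      refine (hd2.comp (Ψ x₀) hd'.hasFDerivAt).unique
        ((hasFDerivAt_id (Ψ x₀)).congr_of_eventuallyEq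
          (Ψ.eventually_right_inverse (Ψ.map_source hxΨ)))
    exact ⟨ContinuousLinearEquiv.equivOfInverse _ _ (DFunLike.congr_fun h2)
      (DFunLike.congr_fun h1)⟩
  -- Pulling back the single chart `Ψ` along the symmetries gives slice charts everywhere, with the
  -- same `V` and `F`.
  choose T hT hTM using fun m : M => hom (ι m) ⟨m, rfl⟩
  obtain ⟨cs, h⟩ := exists_smoothEmbedding_of_sliceCharts hι L
    (fun m => (T m).toHomeomorph.transOpenPartialHomeomorph Ψ)
    (fun m => hΨ.precomp (T m) (hTM m)) (fun m => by
      change T m (ι m) ∈ Ψ.source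
      rwa [hT m])
  exact ⟨n, cs, h⟩

/-! ### Smooth maps into submanifolds and out of submersions -/

/-- An immersion detects smoothness of continuous maps, and the topological embedding supplies the
continuity. Smoothness into any of the submanifolds thereby becomes a statement about operators. -/
theorem contMDiffOn_of_comp_smoothEmbedding {EX EN EV HX HN HV X N V : Type*}
    [NormedAddCommGroup EX] [NormedSpace ℝ EX] [NormedAddCommGroup EN] [NormedSpace ℝ EN]
    [NormedAddCommGroup EV] [NormedSpace ℝ EV] [TopologicalSpace HX] [TopologicalSpace HN]
    [TopologicalSpace HV] {I : ModelWithCorners ℝ EX HX} {J : ModelWithCorners ℝ EN HN}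
    {K : ModelWithCorners ℝ EV HV} [TopologicalSpace X] [TopologicalSpace N] [TopologicalSpace V]
    [ChartedSpace HX X] [ChartedSpace HN N] [ChartedSpace HV V] {ι : N → V}
    (hι : Manifold.IsSmoothEmbedding J K ∞ ι) {f : X → N} {s : Set X} (hs : IsOpen s)
    (hf : ContMDiffOn I K ∞ (ι ∘ f) s) : ContMDiffOn I J ∞ f s := fun x hx => by
  have hx' := hf.contMDiffAt (hs.mem_nhds hx)
  exact ((ContMDiffAt.iff_comp_isImmersionAt (hι.isImmersion.isImmersionAt (f x))).2
    ⟨(hι.isEmbedding.continuousAt_iff).2 hx'.continuousAt, hx'⟩).contMDiffWithinAt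

theorem contMDiff_of_comp_smoothEmbedding {EX EN EV HX HN HV X N V : Type*}
    [NormedAddCommGroup EX] [NormedSpace ℝ EX] [NormedAddCommGroup EN] [NormedSpace ℝ EN]
    [NormedAddCommGroup EV] [NormedSpace ℝ EV] [TopologicalSpace HX] [TopologicalSpace HN]
    [TopologicalSpace HV] {I : ModelWithCorners ℝ EX HX} {J : ModelWithCorners ℝ EN HN}
    {K : ModelWithCorners ℝ EV HV} [TopologicalSpace X] [TopologicalSpace N] [TopologicalSpace V]
    [ChartedSpace HX X] [ChartedSpace HN N] [ChartedSpace HV V] {ι : N → V}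
    (hι : Manifold.IsSmoothEmbedding J K ∞ ι) {f : X → N}
    (hf : ContMDiff I K ∞ (ι ∘ f)) : ContMDiff I J ∞ f :=
  contMDiffOn_univ.1 (contMDiffOn_of_comp_smoothEmbedding hι isOpen_univ hf.contMDiffOn)

/-- A map out of the image of a submersion is smooth if its composition with the submersion is. -/
theorem contMDiff_of_comp_submersion {EP EN EX HX P N X : Type*}
    [NormedAddCommGroup EP] [NormedSpace ℝ EP] [NormedAddCommGroup EN] [NormedSpace ℝ EN]
    [NormedAddCommGroup EX] [NormedSpace ℝ EX] [TopologicalSpace HX]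
    {J : ModelWithCorners ℝ EX HX} [TopologicalSpace P] [TopologicalSpace N] [TopologicalSpace X]
    [ChartedSpace EP P] [ChartedSpace EN N] [ChartedSpace HX X] {π : P → N}
    (hπ : Manifold.IsSubmersion 𝓘(ℝ, EP) 𝓘(ℝ, EN) ∞ π) (hsurj : Function.Surjective π) {f : N → X}
    (hf : ContMDiff 𝓘(ℝ, EP) J ∞ (f ∘ π)) : ContMDiff 𝓘(ℝ, EN) J ∞ f := by
  intro x
  obtain ⟨p, rfl⟩ := hsurj x
  have h := hπ.isSubmersionOfComplement_complement p
  have hw : ∀ z ∈ h.domChart.target, h.codChart (π (h.domChart.symm z)) = (h.equiv z).1 :=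
    fun z hz => h.writtenInCharts (by simpa using hz)
  have hp := h.mem_domChart_source
  have hc := h.mem_codChart_source
  -- Freezing the complementary coordinate at its value at `p` gives a smooth local section `s` of
  -- `π` through `p`; near `π p`, `f = (f ∘ π) ∘ s`.
  let w : EN → EP := fun u => h.equiv.symm (u, (h.equiv (h.domChart p)).2)
  have hwc : ContMDiff 𝓘(ℝ, EN) 𝓘(ℝ, EP) ∞ w :=
    (h.equiv.symm.contDiff.comp (contDiff_id.prodMk contDiff_const)).contMDiff
  have hwp : w (h.codChart (π p)) = h.domChart p := by
    have h1 := hw _ (h.domChart.map_source hp)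
    rw [h.domChart.left_inv hp] at h1
    rw [h1]
    simp [w]
  let s : N → P := fun y => h.domChart.symm (w (h.codChart y))
  have hcod : ContMDiffAt 𝓘(ℝ, EN) 𝓘(ℝ, EN) ∞ h.codChart (π p) :=
    contMDiffAt_of_mem_maximalAtlas h.codChart_mem_maximalAtlas hc
  have hs : ContMDiffAt 𝓘(ℝ, EN) 𝓘(ℝ, EP) ∞ s (π p) := by
    refine ContMDiffAt.comp (π p) (g := h.domChart.symm) ?_ ((hwc _).comp (π p) hcod)
    refine contMDiffAt_symm_of_mem_maximalAtlas h.domChart_mem_maximalAtlas ?_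
    rw [hwp]
    exact h.domChart.map_source hp
  refine ((hf (s (π p))).comp (π p) hs).congr_of_eventuallyEq ?_
  have hcont : ContinuousAt (fun y => w (h.codChart y)) (π p) :=
    ((hwc _).comp (π p) hcod).continuousAt
  have htgt : ∀ᶠ y in 𝓝 (π p), w (h.codChart y) ∈ h.domChart.target := by
    refine hcont.eventually_mem (h.domChart.open_target.mem_nhds ?_)
    rw [hwp]
    exact h.domChart.map_source hp
  filter_upwards [htgt, h.codChart.open_source.mem_nhds hc] with y hy hyc
  have h1 := hw _ hy
  have h2 : π (s y) = y := by
    refine h.codChart.injOn (h.mapsto_domChart_source_codChart_source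
      (h.domChart.map_target hy)) hyc ?_
    rw [h1]
    simp [w]
  simp [h2]

/-- A locally trivial smooth map is a submersion. -/
theorem isSubmersion_of_locallyTrivial {EP EN EG P N G : Type*}
    [NormedAddCommGroup EP] [NormedSpace ℝ EP] [NormedAddCommGroup EN] [NormedSpace ℝ EN]
    [NormedAddCommGroup EG] [NormedSpace ℝ EG] [TopologicalSpace P] [TopologicalSpace N]
    [TopologicalSpace G] [ChartedSpace EP P] [ChartedSpace EN N] [ChartedSpace EG G]
    [IsManifold 𝓘(ℝ, EP) ∞ P] [IsManifold 𝓘(ℝ, EN) ∞ N] [IsManifold 𝓘(ℝ, EG) ∞ G] {π : P → N}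
    (h : ∀ x : N, ∃ e : Bundle.Trivialization G π, x ∈ e.baseSet ∧
      ContMDiffOn 𝓘(ℝ, EP) (𝓘(ℝ, EN).prod 𝓘(ℝ, EG)) ∞ e e.source ∧
      ContMDiffOn (𝓘(ℝ, EN).prod 𝓘(ℝ, EG)) 𝓘(ℝ, EP) ∞ e.toOpenPartialHomeomorph.symm e.target) :
    Manifold.IsSubmersion 𝓘(ℝ, EP) 𝓘(ℝ, EN) ∞ π := by
  refine Manifold.IsSubmersionOfComplement.isSubmersion (F := EG) fun p => ?_
  obtain ⟨e, hx, he, he'⟩ := h (π p)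
  have hp : p ∈ e.source := e.mem_source.2 hx
  have hdiff : IsLocalDiffeomorphAt 𝓘(ℝ, EP) (𝓘(ℝ, EN).prod 𝓘(ℝ, EG)) ∞ e p :=
    ⟨⟨e.toPartialEquiv, e.open_source, e.open_target, he, he'⟩, hp, fun _ _ => rfl⟩
  -- The differential of the trivialization identifies the model spaces. It lets the product chart
  -- `D` below take values in `EP`; in this chart `π` is the first projection.
  let L : EP ≃L[ℝ] EN × EG := hdiff.mfderivToContinuousLinearEquiv (by simp)
  let cN := chartAt EN (π p)
  let cG := chartAt EG (e p).2
  have hN : ContMDiffOn 𝓘(ℝ, EN) 𝓘(ℝ, EN) ∞ cN cN.source := contMDiffOn_chart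
  have hN' : ContMDiffOn 𝓘(ℝ, EN) 𝓘(ℝ, EN) ∞ cN.symm cN.target := contMDiffOn_chart_symm
  have hG : ContMDiffOn 𝓘(ℝ, EG) 𝓘(ℝ, EG) ∞ cG cG.source := contMDiffOn_chart
  have hG' : ContMDiffOn 𝓘(ℝ, EG) 𝓘(ℝ, EG) ∞ cG.symm cG.target := contMDiffOn_chart_symm
  let D : OpenPartialHomeomorph P EP :=
    (e.toOpenPartialHomeomorph ≫ₕ cN.prod cG) ≫ₕ L.symm.toHomeomorph.toOpenPartialHomeomorph
  have hDs : ∀ q ∈ D.source, q ∈ e.source ∧ (e q).1 ∈ cN.source ∧ (e q).2 ∈ cG.source :=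
    fun q hq => ⟨hq.1.1, hq.1.2.1, hq.1.2.2⟩
  have hDt : ∀ z ∈ D.target, ((L z).1 ∈ cN.target ∧ (L z).2 ∈ cG.target) ∧
      (cN.symm (L z).1, cG.symm (L z).2) ∈ e.target := fun z hz => ⟨⟨hz.2.1.1, hz.2.1.2⟩, hz.2.2⟩
  have hD : D ∈ IsManifold.maximalAtlas 𝓘(ℝ, EP) ∞ P := by
    rw [IsManifold.mem_maximalAtlas_iff_contMDiffOn]
    have he0 := he.mono fun q hq => (hDs q hq).1
    constructor
    · exact L.symm.contDiff.contMDiff.comp_contMDiffOn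
        ((hN.comp (contMDiff_fst.comp_contMDiffOn he0) fun q hq => (hDs q hq).2.1).prodMk_space
        (hG.comp (contMDiff_snd.comp_contMDiffOn he0) fun q hq => (hDs q hq).2.2))
    · have h1 : ContMDiff 𝓘(ℝ, EP) 𝓘(ℝ, EN) ∞ fun z => (L z).1 :=
        (contDiff_fst.comp L.contDiff).contMDiff
      have h2 : ContMDiff 𝓘(ℝ, EP) 𝓘(ℝ, EG) ∞ fun z => (L z).2 :=
        (contDiff_snd.comp L.contDiff).contMDiff
      exact he'.comp ((hN'.comp h1.contMDiffOn fun z hz => (hDt z hz).1.1).prodMk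
        (hG'.comp h2.contMDiffOn fun z hz => (hDt z hz).1.2)) fun z hz => (hDt z hz).2
  have hproj : ∀ q ∈ e.source, (e q).1 = π q := fun q hq => e.proj_toFun q hq
  refine Manifold.IsSubmersionAtOfComplement.mk_of_charts L D cN ?_ (mem_chart_source EN (π p)) hD
    (IsManifold.chart_mem_maximalAtlas (π p)) ?_ ?_
  · refine ⟨⟨hp, ?_, mem_chart_source EG _⟩, trivial⟩
    change (e p).1 ∈ cN.source
    rw [hproj p hp]
    exact mem_chart_source EN (π p)
  · intro q hq
    rw [mem_preimage, ← hproj q (hDs q hq).1]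
    exact (hDs q hq).2.1
  · intro z hz
    have hz' : z ∈ D.target := by simpa using hz
    change cN (π (e.toOpenPartialHomeomorph.symm (cN.symm (L z).1, cG.symm (L z).2))) = (L z).1
    rw [← hproj _ (e.map_target (hDt z hz').2)]
    have h3 : e (e.toOpenPartialHomeomorph.symm (cN.symm (L z).1, cG.symm (L z).2)) =
      (cN.symm (L z).1, cG.symm (L z).2) := e.right_inv (hDt z hz').2
    rw [h3]
    exact cN.right_inv (hDt z hz').1.1

/-- A smooth local section of a map whose fibers are the orbits of a free action gives a smooth
equivariant local trivialization. -/
theorem exists_trivialization_of_section {EP EN EG P N G : Type*}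
    [NormedAddCommGroup EP] [NormedSpace ℝ EP] [NormedAddCommGroup EN] [NormedSpace ℝ EN]
    [NormedAddCommGroup EG] [NormedSpace ℝ EG] [TopologicalSpace P] [TopologicalSpace N]
    [TopologicalSpace G] [ChartedSpace EP P] [ChartedSpace EN N] [ChartedSpace EG G]
    [Group G] [MulAction Gᵐᵒᵖ P] {π : P → N} (hπ : ContMDiff 𝓘(ℝ, EP) 𝓘(ℝ, EN) ∞ π)
    (hact : ContMDiff (𝓘(ℝ, EP).prod 𝓘(ℝ, EG)) 𝓘(ℝ, EP) ∞
      (fun x : P × G => MulOpposite.op x.2 • x.1))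
    (hfree : ∀ (p : P) (a : G), MulOpposite.op a • p = p → a = 1)
    (horb : ∀ (p : P) (a : G), π (MulOpposite.op a • p) = π p)
    {V : Set N} (hV : IsOpen V) {sec : N → P} (hsec : ContMDiffOn 𝓘(ℝ, EN) 𝓘(ℝ, EP) ∞ sec V)
    (hsec' : ∀ n ∈ V, π (sec n) = n) {τ : P → G}
    (hτ : ContMDiffOn 𝓘(ℝ, EP) 𝓘(ℝ, EG) ∞ τ (π ⁻¹' V))
    (hτ' : ∀ p, π p ∈ V → MulOpposite.op (τ p) • sec (π p) = p) :
    ∃ e : Bundle.Trivialization G π, e.baseSet = V ∧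
      ContMDiffOn 𝓘(ℝ, EP) (𝓘(ℝ, EN).prod 𝓘(ℝ, EG)) ∞ e e.source ∧
      ContMDiffOn (𝓘(ℝ, EN).prod 𝓘(ℝ, EG)) 𝓘(ℝ, EP) ∞ e.toOpenPartialHomeomorph.symm e.target ∧
      ∀ p ∈ e.source, ∀ a : G, (e (MulOpposite.op a • p)).2 = (e p).2 * a := by
  have hinj : ∀ (p : P) (a b : G), MulOpposite.op a • p = MulOpposite.op b • p → a = b := by
    intro p a b hab
    have h1 : MulOpposite.op (a * b⁻¹) • p = p := by
      rw [MulOpposite.op_mul, mul_smul, hab, ← mul_smul, ← MulOpposite.op_mul]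
      simp
    exact mul_inv_eq_one.1 (hfree p _ h1)
  have hfwd : ContMDiffOn 𝓘(ℝ, EP) (𝓘(ℝ, EN).prod 𝓘(ℝ, EG)) ∞ (fun p => (π p, τ p))
      (π ⁻¹' V) := hπ.contMDiffOn.prodMk hτ
  have hbwd : ContMDiffOn (𝓘(ℝ, EN).prod 𝓘(ℝ, EG)) 𝓘(ℝ, EP) ∞
      (fun x : N × G => MulOpposite.op x.2 • sec x.1) (V ×ˢ univ) :=
    hact.comp_contMDiffOn ((hsec.comp contMDiff_fst.contMDiffOn fun x hx => hx.1).prodMk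
      contMDiff_snd.contMDiffOn)
  let e : Bundle.Trivialization G π :=
    { toFun := fun p => (π p, τ p)
      invFun := fun x => MulOpposite.op x.2 • sec x.1
      source := π ⁻¹' V
      target := V ×ˢ univ
      map_source' := fun p hp => ⟨hp, trivial⟩
      map_target' := fun x hx => by
        rw [mem_preimage, horb, hsec' _ hx.1]
        exact hx.1
      left_inv' := fun p hp => hτ' p hp
      right_inv' := fun x hx => by
        have h1 : π (MulOpposite.op x.2 • sec x.1) = x.1 := by rw [horb, hsec' _ hx.1]
        refine Prod.ext h1 (hinj (sec x.1) _ _ ?_)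
        have h2 := hτ' (MulOpposite.op x.2 • sec x.1) (by rw [h1]; exact hx.1)
        rwa [h1] at h2
      open_source := hV.preimage hπ.continuous
      open_target := hV.prod isOpen_univ
      continuousOn_toFun := hfwd.continuousOn
      continuousOn_invFun := hbwd.continuousOn
      baseSet := V
      open_baseSet := hV
      source_eq := rfl
      target_eq := rfl
      proj_toFun := fun _ _ => rfl }
  refine ⟨e, rfl, hfwd, hbwd, fun p hp a => ?_⟩
  change τ (MulOpposite.op a • p) = τ p * a
  refine hinj (sec (π p)) _ _ ?_
  have h2 := hτ' (MulOpposite.op a • p) (by rw [horb]; exact hp)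
  rw [horb] at h2
  rw [h2, MulOpposite.op_mul, mul_smul, hτ' p hp]

/-! ### The unitary part of an operator near the identity -/

/-- The Sylvester operator `c ↦ t c + c s` is close to multiplication by `2`, hence injective. It
stands in for functional calculus: a square root near `1` inherits self-adjointness and commutation
relations from its square. -/
theorem eq_zero_of_mul_add_mul_eq_zero {A : Type*} [NormedRing A] [NormedAlgebra ℝ A] {s t c : A}
    (hs : ‖1 - s‖ < 1) (ht : ‖1 - t‖ < 1) (h : t * c + c * s = 0) : c = 0 := by
  have h1 : (2 : ℝ) • c = (1 - t) * c + c * (1 - s) := by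
    rw [two_smul, sub_mul, mul_sub, one_mul, mul_one, sub_add_sub_comm, h, sub_zero]
  have h2 : 2 * ‖c‖ ≤ ‖1 - t‖ * ‖c‖ + ‖c‖ * ‖1 - s‖ := by
    calc 2 * ‖c‖ = ‖(2 : ℝ) • c‖ := by rw [norm_smul]; norm_num
      _ ≤ _ := by
        rw [h1]
        exact (norm_add_le _ _).trans (add_le_add (norm_mul_le _ _) (norm_mul_le _ _))
  by_contra hc
  have h3 : 0 < ‖c‖ := norm_pos_iff.2 hc
  nlinarith

/-- Inverse function theorem for `x ↦ x * x`, whose derivative at `1` is multiplication by `2`. -/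
theorem exists_sqrt_near_one (A : Type*) [NormedRing A] [NormedAlgebra ℝ A] [CompleteSpace A] :
    ∃ S : A → A, ContDiffAt ℝ ω S 1 ∧ S 1 = 1 ∧ ∀ᶠ y in 𝓝 1, S y * S y = y := by
  have hω : (ω : WithTop ℕ∞) ≠ 0 := by simp
  let f : A → A := fun x => x * x
  have hf : ContDiffAt ℝ ω f 1 := contDiffAt_id.mul contDiffAt_id
  let L : A ≃L[ℝ] A := ContinuousLinearEquiv.smulLeft (Units.mk0 (2 : ℝ) two_ne_zero)
  have hd : HasFDerivAt f (L : A →L[ℝ] A) 1 := by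
    refine ((hasFDerivAt_id (1 : A)).mul' (hasFDerivAt_id (1 : A))).congr_fderiv ?_
    ext v
    change (1 : A) • v + MulOpposite.op (1 : A) • v = (2 : ℝ) • v
    simp [two_smul]
  let e := hf.toOpenPartialHomeomorph f hd hω
  have h1 : (1 : A) ∈ e.source := hf.mem_toOpenPartialHomeomorph_source hd hω
  have he1 : e 1 = 1 := mul_one 1
  have hs1 : e.symm 1 = 1 := by
    conv_lhs => rw [← he1]
    exact e.left_inv h1
  have ht : (1 : A) ∈ e.target := by
    conv => rw [← he1]
    exact e.map_source h1
  refine ⟨e.symm, e.contDiffAt_symm (f₀' := L) ht ?_ ?_, hs1, e.eventually_right_inverse ht⟩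
  · rw [hs1]; exact hd
  · rw [hs1]; exact hf

/-- This is the polar part `w (w†w)^(-1/2)`. If `y w = w x` with `x`, `y` self-adjoint, taking
adjoints gives `x w† = w† y`, so `w†w` commutes with `x`; so do its square root and the inverse of
that, and `Q w` still intertwines. -/
theorem exists_unitary_part (A : Type*) [NormedRing A] [NormedAlgebra ℝ A] [CompleteSpace A]
    [StarRing A] [NormedStarGroup A] [StarModule ℝ A] :
    ∃ Q : A → A, ContDiffAt ℝ ω Q 1 ∧ ∀ᶠ w in 𝓝 1,
      Q w ∈ unitary A ∧ (w ∈ unitary A → Q w = w) ∧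
      ∀ x y, IsSelfAdjoint x → IsSelfAdjoint y → y * w = w * x → y * Q w = Q w * x := by
  obtain ⟨S, hS, hS1, hSS⟩ := exists_sqrt_near_one A
  have hY : ContDiff ℝ ω (fun w : A => star w * w) :=
    (starL' ℝ : A ≃L[ℝ] A).contDiff.mul contDiff_id
  have hSY : ContDiffAt ℝ ω (fun w : A => S (star w * w)) 1 := by
    refine ContDiffAt.comp (1 : A) (g := S) ?_ hY.contDiffAt
    simpa using hS
  have hSY1 : S (star (1 : A) * 1) = 1 := by simp [hS1]
  refine ⟨fun w => w * Ring.inverse (S (star w * w)), contDiffAt_id.mul ?_, ?_⟩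
  · refine ContDiffAt.comp (1 : A) (g := Ring.inverse) ?_ hSY
    rw [hSY1]
    exact contDiffAt_ringInverse ℝ (1 : Aˣ)
  have hlim : Tendsto (fun w : A => star w * w) (𝓝 1) (𝓝 1) := by
    simpa using hY.continuous.tendsto (1 : A)
  have hlimS : Tendsto (fun w : A => S (star w * w)) (𝓝 1) (𝓝 1) := by
    simpa [ContinuousAt, hS1] using hSY.continuousAt
  have hunit : ∀ᶠ s : A in 𝓝 1, IsUnit s := Units.isOpen.mem_nhds isUnit_one
  have hnorm : ∀ᶠ s : A in 𝓝 1, ‖1 - s‖ < 1 := by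
    have h : Tendsto (fun s : A => ‖1 - s‖) (𝓝 1) (𝓝 0) := by
      have := (continuous_const.sub continuous_id).norm.tendsto (1 : A) (f := fun s : A => ‖1 - s‖)
      simpa using this
    exact h.eventually_lt_const one_pos
  filter_upwards [hunit, hlim.eventually hSS, hlimS.eventually hunit, hlimS.eventually hnorm]
    with w hw hsq hu hn
  set s := S (star w * w) with hsdef
  have hnstar : ‖1 - star s‖ < 1 := by
    have h : 1 - star s = star (1 - s) := by simp
    rwa [h, norm_star]
  have hsa : star s = s := by
    -- Both `s` and `star s` are square roots of `w†w`; the Sylvester equation is applied to `star s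
    -- - s`.
    refine sub_eq_zero.1 (eq_zero_of_mul_add_mul_eq_zero hn hnstar ?_)
    have h : star s * star s = s * s := by rw [← star_mul, hsq]; simp
    rw [mul_sub, sub_mul, h]
    abel
  have hcomm : ∀ x, star w * w * x = x * (star w * w) → s * x = x * s := by
    intro x hx
    refine sub_eq_zero.1 (eq_zero_of_mul_add_mul_eq_zero hn hn ?_)
    rw [← hsq] at hx
    rw [mul_sub, sub_mul, ← mul_assoc, hx]
    simp only [mul_assoc]
    abel
  set i := Ring.inverse s with hidef
  have hsi : s * i = 1 := Ring.mul_inverse_cancel s hu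
  have his : i * s = 1 := Ring.inverse_mul_cancel s hu
  have hia : star i = i := by
    have h : star i * s = 1 := by
      conv_lhs => rw [← hsa]
      rw [← star_mul, hsi, star_one]
    exact left_inv_eq_right_inv h hsi
  have hleft : star (w * i) * (w * i) = 1 := by
    rw [star_mul, hia, mul_assoc, ← mul_assoc (star w), ← hsq, ← mul_assoc, ← mul_assoc, his,
      one_mul, hsi]
  refine ⟨Unitary.mem_iff.2 ⟨hleft, ?_⟩, ?_, ?_⟩
  -- `w * i` is invertible, so its left inverse is also a right inverse.
  · obtain ⟨v, hv⟩ := hw.mul ⟨⟨i, s, his, hsi⟩, rfl⟩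
    rw [← hv] at hleft ⊢
    rw [left_inv_eq_right_inv hleft (Units.mul_inv v)]
    exact Units.mul_inv v
  · intro hwu
    have h1 : s = 1 := by rw [hsdef, (Unitary.mem_iff.1 hwu).1, hS1]
    rw [hidef, h1, Ring.inverse_one, mul_one]
  · intro x y hx hy hxy
    have h1 : x * star w = star w * y := by
      have := congrArg star hxy
      rw [star_mul, star_mul, hx.star_eq, hy.star_eq] at this
      exact this.symm
    have h2 : s * x = x * s := by
      refine hcomm x ?_
      rw [mul_assoc, ← hxy, ← mul_assoc, ← h1, mul_assoc]
    have h3 : i * x = x * i := by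
      calc i * x = i * (x * s) * i := by rw [mul_assoc, mul_assoc, hsi, mul_one]
        _ = x * i := by rw [← h2, ← mul_assoc, his, one_mul]
    rw [← mul_assoc, hxy, mul_assoc, mul_assoc, h3]

/-! ### Spectral projections as polynomials -/

open Polynomial in
/-- The Lagrange basis polynomials of the spectrum of a diagonalizable operator evaluate to
its spectral projections. -/
theorem exists_spectral_polynomials {A : Type*} [Ring A] [Algebra ℂ A] (s : Finset ℂ) :
    ∃ p : ℂ → ℂ[X], ∀ y : A, aeval y (∏ a ∈ s, (X - C a)) = 0 →
      (∀ a ∈ s, y * aeval y (p a) = a • aeval y (p a)) ∧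
      ∑ a ∈ s, aeval y (p a) * aeval y (p a) = 1 := by
  refine ⟨Lagrange.basis s id, fun y hy => ?_⟩
  have hmul : ∀ a ∈ s, y * aeval y (Lagrange.basis s id a) = a • aeval y (Lagrange.basis s id a) :=
      by
    intro a ha
    have hdvd : (∏ a ∈ s, (X - C a)) ∣ (X - C a) * Lagrange.basis s id a := by
      have h1 : (∏ b ∈ s, (X - C b)) = (X - C a) * ∏ b ∈ s.erase a, (X - C b) :=
        (Finset.mul_prod_erase s _ ha).symm
      rw [h1]
      refine mul_dvd_mul_left _ ?_
      rw [Lagrange.basis]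
      refine Finset.prod_dvd_prod_of_dvd _ _ fun b hb => ?_
      rw [Lagrange.basisDivisor]
      exact dvd_mul_left _ _
    have h2 : aeval y ((X - C a) * Lagrange.basis s id a) = 0 := by
      obtain ⟨q, hq⟩ := hdvd
      rw [hq, map_mul, hy, zero_mul]
    rw [map_mul, map_sub, aeval_X, aeval_C, sub_mul, sub_eq_zero] at h2
    rw [h2, Algebra.smul_def]
  refine ⟨hmul, ?_⟩
  -- On the image of `p_a(y)` the element `y` acts as `a`, hence `q(y)` as `q(a)`. Taking `q = p_a`
  -- makes `p_a(y)` idempotent, so the sum of squares is the sum of the Lagrange basis.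
  have hev : ∀ a ∈ s, ∀ q : ℂ[X], aeval y q * aeval y (Lagrange.basis s id a) =
      q.eval a • aeval y (Lagrange.basis s id a) := by
    intro a ha q
    induction q using Polynomial.induction_on' with
    | add q r hq hr => rw [map_add, add_mul, hq, hr, eval_add, add_smul]
    | monomial n c =>
      have hpow : y ^ n * aeval y (Lagrange.basis s id a) =
          a ^ n • aeval y (Lagrange.basis s id a) := by
        induction n with
        | zero => simp
        | succ n ih => rw [pow_succ, mul_assoc, hmul a ha, mul_smul_comm, ih, smul_smul, pow_succ']
      rw [aeval_monomial, mul_assoc, hpow, eval_monomial, mul_smul, ← Algebra.smul_def]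
  have hinj : Set.InjOn (id : ℂ → ℂ) s := Function.injective_id.injOn
  rw [Finset.sum_congr rfl fun a ha => hev a ha _]
  have h1 : ∀ a ∈ s, (Lagrange.basis s id a).eval a • aeval y (Lagrange.basis s id a) =
      aeval y (Lagrange.basis s id a) := fun a ha => by
    have := Lagrange.eval_basis_self hinj ha
    simp only [id] at this
    rw [this, one_smul]
  rw [Finset.sum_congr rfl h1, ← map_sum]
  -- For empty `s` the annihilating product is `1`, which forces the trivial ring.
  rcases s.eq_empty_or_nonempty with rfl | hs
  · have h0 : (1 : A) = 0 := by simpa using hy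
    simp [h0]
  · rw [Lagrange.sum_basis hinj hs, map_one]

-- An orthonormal eigenbasis exists, and the product over the distinct eigenvalues kills each
-- eigenvector.
open Polynomial in
theorem exists_annihilating_polynomial {H : Type*} [NormedAddCommGroup H] [InnerProductSpace ℂ H]
    [CompleteSpace H] [FiniteDimensional ℂ H] {ρ : H →L[ℂ] H} (hρ : IsSelfAdjoint ρ) :
    ∃ s : Finset ℂ, aeval ρ (∏ a ∈ s, (X - C a)) = 0 := by
  have hsym : (ρ : H →ₗ[ℂ] H).IsSymmetric := hρ.isSymmetric
  let b := hsym.eigenvectorBasis rfl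
  let s : Finset ℂ := Finset.univ.image fun i => (RCLike.ofReal (hsym.eigenvalues rfl i) : ℂ)
  have hcoe : ∀ q : ℂ[X], ∀ v, aeval ρ q v = aeval (ρ : H →ₗ[ℂ] H) q v := by
    intro q v
    induction q using Polynomial.induction_on' generalizing v with
    | add q r hq hr => simp [hq, hr]
    | monomial n c =>
      simp only [aeval_monomial, Algebra.algebraMap_eq_smul_one, smul_mul_assoc, one_mul]
      change c • (ρ ^ n) v = c • ((ρ : H →ₗ[ℂ] H) ^ n) v
      rw [FunLike.coe_pow_eq_iterate, Module.End.coe_pow]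
      rfl
  refine ⟨s, ?_⟩
  refine ContinuousLinearMap.coe_injective (b.toBasis.ext fun i => ?_)
  have he := hsym.hasEigenvector_eigenvectorBasis rfl i
  change aeval ρ (∏ a ∈ s, (X - C a)) (b.toBasis i) = 0
  have hmem : (RCLike.ofReal (hsym.eigenvalues rfl i) : ℂ) ∈ s :=
    Finset.mem_image_of_mem (fun i => (RCLike.ofReal (hsym.eigenvalues rfl i) : ℂ)) (Finset.mem_univ i)
  have hzero : (∏ a ∈ s, (X - C a)).eval (RCLike.ofReal (hsym.eigenvalues rfl i) : ℂ) = 0 := by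
    rw [eval_prod]
    exact Finset.prod_eq_zero hmem (by simp)
  rw [hcoe, OrthonormalBasis.coe_toBasis]
  exact (Module.End.aeval_apply_of_hasEigenvector he).trans (by rw [hzero, zero_smul])

/-! ### The level sets and the isotropy group -/

section Operators

variable {H : Type*} [NormedAddCommGroup H] [InnerProductSpace ℂ H] [CompleteSpace H]

/-- In an orthonormal basis the trace is `∑ ‖A (b i)‖ ^ 2`. -/
theorem eq_zero_of_tr_star_mul_self [FiniteDimensional ℂ H] {A : H →L[ℂ] H}
    (h : tr (star A * A) = 0) : A = 0 := by
  have b := stdOrthonormalBasis ℂ H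
  unfold tr at h
  rw [LinearMap.trace_eq_sum_inner _ b] at h
  have hi : ∀ i, inner ℂ (b i) ((star A * A) (b i)) = ((‖A (b i)‖ ^ 2 : ℝ) : ℂ) := fun i => by
    simp [ContinuousLinearMap.star_eq_adjoint, ContinuousLinearMap.adjoint_inner_right]
  have h2 : ∑ i, ‖A (b i)‖ ^ 2 = 0 := by
    have h3 : ∑ i, ((‖A (b i)‖ ^ 2 : ℝ) : ℂ) = 0 := by
      rw [← h]
      exact Finset.sum_congr rfl fun i _ => (hi i).symm
    exact_mod_cast h3
  rw [Finset.sum_eq_zero_iff_of_nonneg fun i _ => sq_nonneg _] at h2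
  refine ContinuousLinearMap.coe_injective (b.toBasis.ext fun i => ?_)
  simpa using h2 i (Finset.mem_univ i)

/-- The difference `M` of the two sides is Hermitian, so `i M` is an admissible test vector; pairing
with it gives `Tr(M†M) = 0`. -/
theorem J_eq_J_iff [FiniteDimensional ℂ H] {ħ : ℝ} (hħ : ħ ≠ 0) (φ ψ : H →L[ℂ] H) :
    J ħ φ = J ħ ψ ↔ star φ * φ = star ψ * ψ := by
  constructor
  · intro h
    set M := star φ * φ - star ψ * ψ with hM
    have hsa : star M = M := by simp [hM]
    have hskew : Complex.I • M ∈ skewAdjoint (H →L[ℂ] H) := by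
      rw [skewAdjoint.mem_iff, star_smul, hsa]
      simp
    have h1 := congrArg (fun x : ℝ => (x : ℂ)) (DFunLike.congr_fun h ⟨_, hskew⟩)
    simp only [ofReal_J_apply] at h1
    have h2 := mul_left_cancel₀
      (mul_ne_zero Complex.I_ne_zero (Complex.ofReal_ne_zero.2 hħ)) h1
    have h3 : tr (M * (Complex.I • M)) = 0 := by
      have h4 : tr (M * (Complex.I • M)) = tr (star φ * φ * (Complex.I • M)) -
          tr (star ψ * ψ * (Complex.I • M)) := by
        conv_lhs => enter [1, 1]; rw [hM]
        rw [sub_mul]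
        simp [tr]
      rw [h4, sub_eq_zero]
      exact h2
    have h5 : tr (M * (Complex.I • M)) = Complex.I * tr (star M * M) := by
      rw [mul_smul_comm, hsa]
      simp [tr]
    rw [h5] at h3
    exact sub_eq_zero.1 (eq_zero_of_tr_star_mul_self
      ((mul_eq_zero.1 h3).resolve_left Complex.I_ne_zero))
  · intro h
    ext ξ
    simp only [J, LinearMap.coe_mk, AddHom.coe_mk, h]

theorem mem_levelSet_iff [FiniteDimensional ℂ H] {ħ : ℝ} (hħ : ħ ≠ 0) (φ ψ : H →L[ℂ] H) :
    φ ∈ levelSet ħ ψ ↔ IsUnit φ ∧ star φ * φ = star ψ * ψ := by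
  rw [← J_eq_J_iff hħ]
  rfl

theorem mem_isotropyGroup_iff [FiniteDimensional ℂ H] {ħ : ℝ} (hħ : ħ ≠ 0) (ψ : H →L[ℂ] H)
    (U : unitary (H →L[ℂ] H)) : U ∈ isotropyGroup ħ ψ ↔
      (U : H →L[ℂ] H) * (star ψ * ψ) = (star ψ * ψ) * (U : H →L[ℂ] H) := by
  have h1 : U ∈ isotropyGroup ħ ψ ↔ J ħ (ψ * (U : H →L[ℂ] H)) = J ħ ψ := by
    rw [J_mul_unitary]
    rfl
  rw [h1, J_eq_J_iff hħ, star_mul]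
  constructor
  · intro h
    conv_lhs => rw [← h]
    simp only [← mul_assoc, Unitary.mul_star_self_of_mem U.2, one_mul]
  · intro h
    have h2 : star (U : H →L[ℂ] H) * star ψ * (ψ * U) =
        star (U : H →L[ℂ] H) * ((star ψ * ψ) * U) := by simp only [mul_assoc]
    rw [h2, ← h, ← mul_assoc, Unitary.star_mul_self_of_mem U.2, one_mul]

theorem mem_unitary_of_isUnit {A : Type*} [Monoid A] [StarMul A] {u : A} (hu : IsUnit u)
    (h : star u * u = 1) : u ∈ unitary A := by
  obtain ⟨v, rfl⟩ := hu
  refine Unitary.mem_iff.2 ⟨h, ?_⟩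
  rw [left_inv_eq_right_inv h (Units.mul_inv v)]
  exact Units.mul_inv v

/-- The level set is the orbit of `ψ` under left multiplication by unitaries. -/
theorem exists_unitary_of_mem_levelSet [FiniteDimensional ℂ H] {ħ : ℝ} (hħ : ħ ≠ 0)
    {φ ψ : H →L[ℂ] H} (hψ : IsUnit ψ) (hφ : φ ∈ levelSet ħ ψ) :
    ∃ V ∈ unitary (H →L[ℂ] H), φ = V * ψ := by
  obtain ⟨hu, hP⟩ := (mem_levelSet_iff hħ φ ψ).1 hφ
  obtain ⟨u, rfl⟩ := hψ
  refine ⟨φ * ↑u⁻¹, mem_unitary_of_isUnit (hu.mul u⁻¹.isUnit) ?_, by simp⟩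
  have h1 : star (φ * (↑u⁻¹ : H →L[ℂ] H)) * (φ * ↑u⁻¹) =
      star (↑u⁻¹ : H →L[ℂ] H) * (star φ * φ) * ↑u⁻¹ := by
    rw [star_mul]
    simp only [mul_assoc]
  rw [h1, hP, mul_assoc, mul_assoc, Units.mul_inv, mul_one, ← star_mul, Units.mul_inv, star_one]

theorem unitary_mul_mem_levelSet [FiniteDimensional ℂ H] {ħ : ℝ} (hħ : ħ ≠ 0)
    {φ ψ V : H →L[ℂ] H} (hV : V ∈ unitary (H →L[ℂ] H)) (hφ : φ ∈ levelSet ħ ψ) :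
    V * φ ∈ levelSet ħ ψ := by
  obtain ⟨hu, hP⟩ := (mem_levelSet_iff hħ φ ψ).1 hφ
  refine (mem_levelSet_iff hħ _ ψ).2 ⟨(Unitary.toUnits ⟨V, hV⟩).isUnit.mul hu, ?_⟩
  rw [star_mul, mul_assoc, ← mul_assoc (star V), Unitary.star_mul_self_of_mem hV, one_mul, hP]

theorem self_mem_levelSet {ħ : ℝ} {ψ : H →L[ℂ] H} (hψ : IsUnit ψ) : ψ ∈ levelSet ħ ψ :=
  ⟨hψ, rfl⟩

theorem mapsTo_proj [FiniteDimensional ℂ H] {ħ : ℝ} (hħ : ħ ≠ 0) {ψ : H →L[ℂ] H}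
    (hψ : IsUnit ψ) : MapsTo proj (levelSet ħ ψ) (isospectralOrbit (proj ψ)) := by
  intro φ hφ
  obtain ⟨V, hV, rfl⟩ := exists_unitary_of_mem_levelSet hħ hψ hφ
  refine ⟨⟨V, hV⟩, ?_⟩
  simp only [proj, star_mul, mul_assoc]

theorem proj_mul_unitary (φ : H →L[ℂ] H) {U : H →L[ℂ] H} (hU : U ∈ unitary (H →L[ℂ] H)) :
    proj (φ * U) = proj φ := by
  rw [proj, proj, star_mul, mul_assoc, ← mul_assoc U, Unitary.mul_star_self_of_mem hU, one_mul]

/-- Two points of the level set in the same fiber differ by an element of the isotropy group. -/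
theorem exists_isotropy_of_proj_eq [FiniteDimensional ℂ H] {ħ : ℝ} (hħ : ħ ≠ 0)
    {ψ : H →L[ℂ] H} (φ φ' : levelSet ħ ψ)
    (h : proj (φ : H →L[ℂ] H) = proj (φ' : H →L[ℂ] H)) :
    ∃ a : isotropyGroup ħ ψ, φ' = MulOpposite.op a • φ := by
  obtain ⟨hu, hP⟩ := (mem_levelSet_iff hħ _ ψ).1 φ.2
  obtain ⟨hu', hP'⟩ := (mem_levelSet_iff hħ _ ψ).1 φ'.2
  obtain ⟨u, hu⟩ := hu
  have hunit : IsUnit ((↑u⁻¹ : H →L[ℂ] H) * φ') := u⁻¹.isUnit.mul hu'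
  -- The only candidate is `φ⁻¹φ'`; equality of `φφ†` and `φ'φ'†` makes it a coisometry, and
  -- invertibility makes it unitary.
  have hmem : (↑u⁻¹ : H →L[ℂ] H) * φ' ∈ unitary (H →L[ℂ] H) := by
    have h1 : (↑u⁻¹ : H →L[ℂ] H) * φ' * star ((↑u⁻¹ : H →L[ℂ] H) * φ') = 1 := by
      have h2 : (↑u⁻¹ : H →L[ℂ] H) * φ' * star ((↑u⁻¹ : H →L[ℂ] H) * φ') =
          ↑u⁻¹ * proj (φ' : H →L[ℂ] H) * star (↑u⁻¹ : H →L[ℂ] H) := by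
        simp only [proj, star_mul, mul_assoc]
      rw [h2, ← h, ← hu, proj, ← mul_assoc, Units.inv_mul, one_mul, ← star_mul, Units.inv_mul,
        star_one]
    have h3 := mem_unitary_of_isUnit hunit.star (by rwa [star_star])
    simpa using Unitary.star_mem h3
  have heq : (φ' : H →L[ℂ] H) = φ * (↑u⁻¹ * φ') := by
    rw [← mul_assoc, ← hu, Units.mul_inv, one_mul]
  -- By equivariance `coAd a (J φ) = J (φ a) = J φ'`, and both ends equal `J ψ`.
  have hiso : coAd ⟨_, hmem⟩ (J ħ ψ) = J ħ ψ := by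
    have h4 := J_mul_unitary ħ (φ : H →L[ℂ] H) ⟨_, hmem⟩
    rw [φ.2.2] at h4
    rw [← h4, ← heq, φ'.2.2]
  exact ⟨⟨⟨_, hmem⟩, hiso⟩, Subtype.ext heq⟩

theorem isospectralOrbit_conj {ρ V : H →L[ℂ] H} (hV : V ∈ unitary (H →L[ℂ] H)) {σ : H →L[ℂ] H} :
    V * σ * star V ∈ isospectralOrbit ρ ↔ σ ∈ isospectralOrbit ρ := by
  have key : ∀ {W τ : H →L[ℂ] H}, W ∈ unitary (H →L[ℂ] H) → τ ∈ isospectralOrbit ρ →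
      W * τ * star W ∈ isospectralOrbit ρ := by
    rintro W _ hW ⟨U, rfl⟩
    refine ⟨⟨W, hW⟩ * U, ?_⟩
    simp only [Submonoid.coe_mul, star_mul, mul_assoc]
  refine ⟨fun h => ?_, key hV⟩
  have h1 := key (Unitary.star_mem hV) h
  have h2 : star V * (V * σ * star V) * star (star V) = (star V * V) * σ * (star V * V) := by
    simp only [star_star, mul_assoc]
  rwa [h2, Unitary.star_mul_self_of_mem hV, one_mul, mul_one] at h1

end Operators

/-! ### Local unitary intertwiners on the isospectral orbit -/

section Sections

variable {H : Type*} [NormedAddCommGroup H] [InnerProductSpace ℂ H] [CompleteSpace H]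

theorem contDiff_aeval (p : Polynomial ℂ) {n : WithTop ℕ∞} :
    ContDiff ℝ n fun y : H →L[ℂ] H => Polynomial.aeval y p := by
  simp only [Polynomial.aeval_eq_sum_range]
  fun_prop

theorem aeval_unitary_conj {U : H →L[ℂ] H} (hU : U ∈ unitary (H →L[ℂ] H)) (ρ : H →L[ℂ] H)
    (p : Polynomial ℂ) :
    Polynomial.aeval (U * ρ * star U) p = U * Polynomial.aeval ρ p * star U := by
  have hpow : ∀ n : ℕ, (U * ρ * star U) ^ n = U * ρ ^ n * star U := by
    intro n
    induction n with
    | zero => simp [Unitary.mul_star_self_of_mem hU]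
    | succ n ih =>
      rw [pow_succ, ih, pow_succ]
      have : U * ρ ^ n * star U * (U * ρ * star U) = U * ρ ^ n * (star U * U) * ρ * star U := by
        simp only [mul_assoc]
      rw [this, Unitary.star_mul_self_of_mem hU, mul_one, mul_assoc U]
  simp only [Polynomial.aeval_eq_sum_range, hpow, Finset.mul_sum, Finset.sum_mul, mul_smul_comm,
    smul_mul_assoc]

theorem isSelfAdjoint_of_mem_isospectralOrbit {ρ σ : H →L[ℂ] H} (hρ : IsSelfAdjoint ρ)
    (hσ : σ ∈ isospectralOrbit ρ) : IsSelfAdjoint σ := by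
  obtain ⟨U, rfl⟩ := hσ
  exact hρ.conjugate _

theorem self_mem_isospectralOrbit (ρ : H →L[ℂ] H) : ρ ∈ isospectralOrbit ρ := ⟨1, by simp⟩

/-- For `y` in the orbit, `p_a(y)` and `p_a(ρ)` are the spectral projections for the same `a`, so `W
y = ∑ p_a(y) p_a(ρ)` satisfies `y W = W ρ`. Since `W ρ = 1`, its unitary part is defined near `ρ`
and still intertwines. Unitarity also holds off the orbit, which makes `y ↦ U y ρ (U y)†` a
retraction. -/
theorem exists_unitary_intertwiner_at [FiniteDimensional ℂ H] {ρ : H →L[ℂ] H}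
    (hρ : IsSelfAdjoint ρ) :
    ∃ U : (H →L[ℂ] H) → (H →L[ℂ] H), ContDiffAt ℝ ω U ρ ∧ ∀ᶠ y in 𝓝 ρ,
      U y ∈ unitary (H →L[ℂ] H) ∧ (y ∈ isospectralOrbit ρ → U y * ρ * star (U y) = y) := by
  obtain ⟨Q, hQ, hQev⟩ := exists_unitary_part (H →L[ℂ] H)
  obtain ⟨s, hs⟩ := exists_annihilating_polynomial hρ
  obtain ⟨p, hp⟩ := exists_spectral_polynomials (A := H →L[ℂ] H) s
  let W : (H →L[ℂ] H) → (H →L[ℂ] H) := fun y =>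
    ∑ a ∈ s, Polynomial.aeval y (p a) * Polynomial.aeval ρ (p a)
  have hW : ContDiff ℝ ω W := ContDiff.sum fun a _ => (contDiff_aeval (p a)).mul contDiff_const
  have hWρ : W ρ = 1 := (hp ρ hs).2
  refine ⟨fun y => Q (W y), ?_, ?_⟩
  · refine ContDiffAt.comp ρ (g := Q) ?_ hW.contDiffAt
    rwa [hWρ]
  have hlim : Tendsto W (𝓝 ρ) (𝓝 1) := by
    simpa [hWρ] using hW.continuous.tendsto ρ
  filter_upwards [hlim.eventually hQev] with y ⟨hyu, _, hy⟩
  refine ⟨hyu, fun hyo => ?_⟩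
  have hya : Polynomial.aeval y (∏ a ∈ s, (Polynomial.X - Polynomial.C a)) = 0 := by
    obtain ⟨U, rfl⟩ := hyo
    rw [aeval_unitary_conj U.2, hs, mul_zero, zero_mul]
  have hint : y * W y = W y * ρ := by
    simp only [W, Finset.mul_sum, Finset.sum_mul]
    refine Finset.sum_congr rfl fun a ha => ?_
    have h1 : Polynomial.aeval ρ (p a) * ρ = ρ * Polynomial.aeval ρ (p a) := by
      conv_lhs => enter [2]; rw [← Polynomial.aeval_X (R := ℂ) ρ]
      conv_rhs => enter [1]; rw [← Polynomial.aeval_X (R := ℂ) ρ]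
      rw [← map_mul, mul_comm, map_mul]
    rw [← mul_assoc, (hp y hya).1 a ha, mul_assoc, h1, (hp ρ hs).1 a ha, smul_mul_assoc,
      mul_smul_comm]
  rw [← hy ρ y hρ (isSelfAdjoint_of_mem_isospectralOrbit hρ hyo) hint, mul_assoc,
    Unitary.mul_star_self_of_mem hyu, mul_one]

/-- Around each point of the isospectral orbit, a unitary that conjugates `ρ` into a given point of
the orbit can be chosen smoothly. -/
theorem exists_unitary_intertwiner [FiniteDimensional ℂ H] {ρ x : H →L[ℂ] H}
    (hρ : IsSelfAdjoint ρ) (hx : x ∈ isospectralOrbit ρ) :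
    ∃ (O : Set (H →L[ℂ] H)) (U : (H →L[ℂ] H) → (H →L[ℂ] H)), IsOpen O ∧ x ∈ O ∧
      ContDiffOn ℝ ∞ U O ∧ ∀ y ∈ O, U y ∈ unitary (H →L[ℂ] H) ∧
        (y ∈ isospectralOrbit ρ → U y * ρ * star (U y) = y) := by
  obtain ⟨U, hU, hUev⟩ := exists_unitary_intertwiner_at hρ
  obtain ⟨O, hO, hOo, hρO⟩ := eventually_nhds_iff.1 (hUev.and (hU.eventually (by simp)))
  obtain ⟨⟨V, hV⟩, rfl⟩ := hx
  have hc : ContDiff ℝ ∞ fun y : H →L[ℂ] H => star V * y * V := by fun_prop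
  have hcancel : ∀ y : H →L[ℂ] H, V * (star V * y * V) * star V = y := fun y => by
    have h2 : V * (star V * y * V) * star V = (V * star V) * y * (V * star V) := by
      simp only [mul_assoc]
    rw [h2, Unitary.mul_star_self_of_mem hV, one_mul, mul_one]
  -- The intertwiner near `ρ` is transported to `x = V ρ V†` by conjugation.
  refine ⟨(fun y => star V * y * V) ⁻¹' O, fun y => V * U (star V * y * V),
    hOo.preimage hc.continuous, ?_, ?_, ?_⟩
  · have h2 : star V * (V * ρ * star V) * V = (star V * V) * ρ * (star V * V) := by
      simp only [mul_assoc]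
    simp only [mem_preimage]
    rwa [h2, Unitary.star_mul_self_of_mem hV, one_mul, mul_one]
  · refine contDiffOn_const.mul (ContDiffOn.comp (g := U) (t := O) ?_ hc.contDiffOn fun y hy => hy)
    exact fun y hy => ((hO y hy).2.of_le le_top).contDiffWithinAt
  · intro y hy
    obtain ⟨⟨h1, h2⟩, -⟩ := hO _ hy
    refine ⟨mul_mem hV h1, fun hyo => ?_⟩
    have h3 := h2 ((isospectralOrbit_conj hV).1 (by rwa [hcancel]))
    have h4 : V * U (star V * y * V) * ρ * star (V * U (star V * y * V)) =
        V * (U (star V * y * V) * ρ * star (U (star V * y * V))) * star V := by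
      simp only [star_mul, mul_assoc]
    rw [h4, h3, hcancel]

theorem exists_mulLeftRight_equiv {V W : H →L[ℂ] H} (hV : V ∈ unitary (H →L[ℂ] H))
    (hW : W ∈ unitary (H →L[ℂ] H)) :
    ∃ T : (H →L[ℂ] H) ≃L[ℝ] (H →L[ℂ] H), ∀ y, T y = V * y * W := by
  have key : ∀ {V W : H →L[ℂ] H}, V * star V = 1 → star W * W = 1 →
      ∀ y, V * (star V * y * star W) * W = y := by
    intro V W hV hW y
    have h : V * (star V * y * star W) * W = (V * star V) * y * (star W * W) := by
      simp only [mul_assoc]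
    rw [h, hV, hW, one_mul, mul_one]
  refine ⟨ContinuousLinearEquiv.equivOfInverse
    (ContinuousLinearMap.mulLeftRight ℝ (H →L[ℂ] H) V W)
    (ContinuousLinearMap.mulLeftRight ℝ (H →L[ℂ] H) (star V) (star W)) (fun y => ?_) (fun y => ?_),
    fun y => ?_⟩
  · have h := key (V := star V) (W := star W) (by simp [Unitary.star_mul_self_of_mem hV])
      (by simp [Unitary.mul_star_self_of_mem hW]) y
    simpa using h
  · simpa using key (Unitary.mul_star_self_of_mem hV) (Unitary.star_mul_self_of_mem hW) y
  · simp

end Sections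

section Bundle

variable {H : Type*} [NormedAddCommGroup H] [InnerProductSpace ℂ H] [CompleteSpace H]

/-! ### Existence of the smooth structures -/

theorem finiteDimensional_real_operators {H : Type*} [NormedAddCommGroup H]
    [InnerProductSpace ℂ H] [FiniteDimensional ℂ H] : FiniteDimensional ℝ (H →L[ℂ] H) := FiniteDimensional.trans ℝ ℂ _

/-- Since `S(ψ) = U(H)ψ`, the unitary part of `y ψ⁻¹` times `ψ` retracts a neighbourhood of `ψ`;
left multiplication by unitaries gives homogeneity. -/
theorem exists_manifold_levelSet [FiniteDimensional ℂ H] {ħ : ℝ} (hħ : ħ ≠ 0) {ψ : H →L[ℂ] H}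
    (hψ : IsUnit ψ) :
    ∃ (n : ℕ) (_ : ChartedSpace (EuclideanSpace ℝ (Fin n)) (levelSet ħ ψ)),
      IsManifold (𝓡 n) ∞ (levelSet ħ ψ) ∧ Manifold.IsSmoothEmbedding (𝓡 n) 𝓘(ℝ, H →L[ℂ] H) ∞
        (Subtype.val : levelSet ħ ψ → H →L[ℂ] H) := by
  have := finiteDimensional_real_operators (H := H)
  obtain ⟨Q, hQ, hQev⟩ := exists_unitary_part (H →L[ℂ] H)
  have ⟨u, hu⟩ := hψ
  have hc : ContDiff ℝ ω fun y : H →L[ℂ] H => y * (↑u⁻¹ : H →L[ℂ] H) := by fun_prop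
  have h1 : ψ * (↑u⁻¹ : H →L[ℂ] H) = 1 := by rw [← hu, Units.mul_inv]
  have hlim : Tendsto (fun y : H →L[ℂ] H => y * (↑u⁻¹ : H →L[ℂ] H)) (𝓝 ψ) (𝓝 1) := by
    simpa [h1] using hc.continuous.tendsto ψ
  refine exists_smoothEmbedding_of_retraction IsEmbedding.subtypeVal (x₀ := ψ)
    (r := fun y => Q (y * ↑u⁻¹) * ψ) ?_ ?_ ?_ ?_ ?_
  · rw [Subtype.range_coe]
    exact self_mem_levelSet hψ
  · refine (ContDiffAt.comp ψ (g := Q) ?_ hc.contDiffAt).mul contDiffAt_const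
    rwa [h1]
  · filter_upwards [hlim.eventually hQev] with y hy
    rw [Subtype.range_coe]
    exact unitary_mul_mem_levelSet hħ hy.1 (self_mem_levelSet hψ)
  · filter_upwards [hlim.eventually hQev] with y hy hyS
    rw [Subtype.range_coe] at hyS
    obtain ⟨V, hV, rfl⟩ := exists_unitary_of_mem_levelSet hħ hψ hyS
    have h2 : V * ψ * ↑u⁻¹ = V := by rw [mul_assoc, h1, mul_one]
    rw [h2] at hy ⊢
    rw [hy.2.1 hV]
  · rw [Subtype.range_coe]
    intro x hx
    obtain ⟨V, hV, rfl⟩ := exists_unitary_of_mem_levelSet hħ hψ hx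
    obtain ⟨T, hT⟩ := exists_mulLeftRight_equiv (Unitary.star_mem hV)
      (one_mem (unitary (H →L[ℂ] H)))
    refine ⟨T, ?_, fun y => ⟨fun h => ?_, fun h => ?_⟩⟩
    · rw [hT, mul_one, ← mul_assoc, Unitary.star_mul_self_of_mem hV, one_mul]
    · rw [hT, mul_one] at h
      have h3 := unitary_mul_mem_levelSet hħ hV h
      rwa [← mul_assoc, Unitary.mul_star_self_of_mem hV, one_mul] at h3
    · rw [hT, mul_one]
      exact unitary_mul_mem_levelSet hħ (Unitary.star_mem hV) h

theorem isEmbedding_isotropyIncl (ħ : ℝ) (ψ : H →L[ℂ] H) : IsEmbedding (isotropyIncl ħ ψ) :=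
  IsEmbedding.subtypeVal.comp IsEmbedding.subtypeVal

theorem mem_range_isotropyIncl [FiniteDimensional ℂ H] {ħ : ℝ} (hħ : ħ ≠ 0) {ψ U : H →L[ℂ] H} :
    U ∈ range (isotropyIncl ħ ψ) ↔
      U ∈ unitary (H →L[ℂ] H) ∧ U * (star ψ * ψ) = (star ψ * ψ) * U := by
  constructor
  · rintro ⟨V, rfl⟩
    exact ⟨V.1.2, (mem_isotropyGroup_iff hħ ψ V.1).1 V.2⟩
  · rintro ⟨h1, h2⟩
    exact ⟨⟨⟨U, h1⟩, (mem_isotropyGroup_iff hħ ψ _).2 h2⟩, rfl⟩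

/-- With `E_a` the spectral projections of `P`, the map `y ↦ ∑ E_a y E_a` projects onto the
commutant of `P`. The unitary part stays in the commutant, so the composition retracts onto `U(ψ)`
near `1`. -/
theorem exists_manifold_isotropyGroup [FiniteDimensional ℂ H] {ħ : ℝ} (hħ : ħ ≠ 0)
    (ψ : H →L[ℂ] H) :
    ∃ (n : ℕ) (_ : ChartedSpace (EuclideanSpace ℝ (Fin n)) (isotropyGroup ħ ψ)),
      IsManifold (𝓡 n) ∞ (isotropyGroup ħ ψ) ∧
        Manifold.IsSmoothEmbedding (𝓡 n) 𝓘(ℝ, H →L[ℂ] H) ∞ (isotropyIncl ħ ψ) := by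
  have := finiteDimensional_real_operators (H := H)
  obtain ⟨Q, hQ, hQev⟩ := exists_unitary_part (H →L[ℂ] H)
  set P := star ψ * ψ with hPdef
  have hP : IsSelfAdjoint P := IsSelfAdjoint.star_mul_self ψ
  obtain ⟨s, hs⟩ := exists_annihilating_polynomial hP
  obtain ⟨p, hp⟩ := exists_spectral_polynomials (A := H →L[ℂ] H) s
  obtain ⟨hmul, hsum⟩ := hp P hs
  have hcomm : ∀ (y : H →L[ℂ] H), y * P = P * y → ∀ q : Polynomial ℂ,
      y * Polynomial.aeval P q = Polynomial.aeval P q * y := by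
    intro y hy q
    have hpow : ∀ n : ℕ, y * P ^ n = P ^ n * y := fun n => (show Commute y P from hy).pow_right n
    simp only [Polynomial.aeval_eq_sum_range, Finset.mul_sum, Finset.sum_mul, mul_smul_comm,
      smul_mul_assoc, hpow]
  let W : (H →L[ℂ] H) → (H →L[ℂ] H) := fun y =>
    ∑ a ∈ s, Polynomial.aeval P (p a) * y * Polynomial.aeval P (p a)
  have hW : ContDiff ℝ ω W := by fun_prop
  have hWfix : ∀ y, y * P = P * y → W y = y := by
    intro y hy
    simp only [W]
    rw [Finset.sum_congr rfl fun a _ => by rw [← hcomm y hy, mul_assoc], ← Finset.mul_sum, hsum,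
      mul_one]
  have hW1 : W 1 = 1 := hWfix 1 (by rw [one_mul, mul_one])
  have hWcomm : ∀ y, P * W y = W y * P := by
    intro y
    simp only [W, Finset.mul_sum, Finset.sum_mul]
    refine Finset.sum_congr rfl fun a ha => ?_
    rw [mul_assoc _ _ P, ← hcomm P rfl, hmul a ha, ← mul_assoc, ← mul_assoc, hmul a ha,
      smul_mul_assoc, smul_mul_assoc, mul_smul_comm]
  have hlim : Tendsto W (𝓝 1) (𝓝 1) := by
    simpa [hW1] using hW.continuous.tendsto 1
  refine exists_smoothEmbedding_of_retraction (isEmbedding_isotropyIncl ħ ψ) (x₀ := 1)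
    (r := fun y => Q (W y)) ⟨1, rfl⟩ ?_ ?_ ?_ ?_
  · refine ContDiffAt.comp 1 (g := Q) ?_ hW.contDiffAt
    rwa [hW1]
  · filter_upwards [hlim.eventually hQev] with y hy
    exact (mem_range_isotropyIncl hħ).2 ⟨hy.1, (hy.2.2 P P hP hP (hWcomm y)).symm⟩
  · filter_upwards [hlim.eventually hQev] with y hy hyG
    obtain ⟨h1, h2⟩ := (mem_range_isotropyIncl hħ).1 hyG
    rw [hWfix y h2] at hy ⊢
    exact hy.2.1 h1
  · rintro _ ⟨V, rfl⟩
    obtain ⟨T, hT⟩ := exists_mulLeftRight_equiv (Unitary.star_mem V.1.2)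
      (one_mem (unitary (H →L[ℂ] H)))
    have hT' : ∀ y, T y = star ((V : unitary (H →L[ℂ] H)) : H →L[ℂ] H) * y := fun y => by
      rw [hT, mul_one]
    refine ⟨T, ?_, fun y => ⟨?_, ?_⟩⟩
    · rw [hT']
      exact Unitary.star_mul_self_of_mem V.1.2
    · rintro ⟨X, hX⟩
      refine ⟨V * X, ?_⟩
      change ((V : unitary (H →L[ℂ] H)) : H →L[ℂ] H) * isotropyIncl ħ ψ X = y
      rw [hX, hT', ← mul_assoc, Unitary.mul_star_self_of_mem V.1.2, one_mul]
    · rintro ⟨X, rfl⟩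
      exact ⟨V⁻¹ * X, (hT' _).symm⟩

/-- An arbitrary embedding `j` is allowed so that the result serves both the orbit and the coset
space. -/
theorem exists_manifold_of_range_eq_isospectralOrbit [FiniteDimensional ℂ H] {ρ : H →L[ℂ] H}
    (hρ : IsSelfAdjoint ρ) {N : Type*} [TopologicalSpace N] {j : N → H →L[ℂ] H}
    (hj : IsEmbedding j) (hrange : range j = isospectralOrbit ρ) :
    ∃ (n : ℕ) (_ : ChartedSpace (EuclideanSpace ℝ (Fin n)) N),
      IsManifold (𝓡 n) ∞ N ∧ Manifold.IsSmoothEmbedding (𝓡 n) 𝓘(ℝ, H →L[ℂ] H) ∞ j := by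
  have := finiteDimensional_real_operators (H := H)
  obtain ⟨U, hU, hUev⟩ := exists_unitary_intertwiner_at hρ
  refine exists_smoothEmbedding_of_retraction hj (x₀ := ρ)
    (r := fun y => U y * ρ * star (U y)) ?_ ?_ ?_ ?_ ?_
  · rw [hrange]
    exact self_mem_isospectralOrbit ρ
  · have h : ContDiffAt ℝ ω (fun y => star (U y)) ρ :=
      (starL' ℝ : (H →L[ℂ] H) ≃L[ℝ] (H →L[ℂ] H)).contDiff.contDiffAt.comp ρ hU
    exact (hU.mul contDiffAt_const).mul h
  · filter_upwards [hUev] with y hy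
    rw [hrange]
    exact ⟨⟨_, hy.1⟩, rfl⟩
  · filter_upwards [hUev] with y hy hyD
    exact hy.2 (by rwa [hrange] at hyD)
  · rw [hrange]
    rintro _ ⟨⟨V, hV⟩, rfl⟩
    obtain ⟨T, hT⟩ := exists_mulLeftRight_equiv (Unitary.star_mem hV) hV
    refine ⟨T, ?_, fun y => ?_⟩
    · have h : star V * (V * ρ * star V) * V = (star V * V) * ρ * (star V * V) := by
        simp only [mul_assoc]
      rw [hT, h, Unitary.star_mul_self_of_mem hV, one_mul, mul_one]
    · rw [hT]
      have h := isospectralOrbit_conj (ρ := ρ) (σ := y) (Unitary.star_mem hV)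
      rwa [star_star] at h

/-! ### The coset space -/

/-- The map that `φ ↦ φ φ†` induces on the coset space. -/
noncomputable def cosetProj (ħ : ℝ) (ψ : H →L[ℂ] H) : cosetSpace ħ ψ → H →L[ℂ] H :=
  Quotient.lift (fun φ : levelSet ħ ψ => proj (φ : H →L[ℂ] H)) (by
    rintro _ b ⟨a, rfl⟩
    exact proj_mul_unitary (b : H →L[ℂ] H) a.unop.1.2)

theorem cosetProj_mk {ħ : ℝ} {ψ : H →L[ℂ] H} (φ : levelSet ħ ψ) :
    cosetProj ħ ψ (cosetMk ħ ψ φ) = proj (φ : H →L[ℂ] H) := rfl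

theorem cosetMk_surjective (ħ : ℝ) (ψ : H →L[ℂ] H) : Function.Surjective (cosetMk ħ ψ) :=
  Quotient.mk_surjective

theorem cosetProj_injective [FiniteDimensional ℂ H] {ħ : ℝ} (hħ : ħ ≠ 0) (ψ : H →L[ℂ] H) :
    Function.Injective (cosetProj ħ ψ) := by
  intro x y hxy
  obtain ⟨φ, rfl⟩ := cosetMk_surjective ħ ψ x
  obtain ⟨φ', rfl⟩ := cosetMk_surjective ħ ψ y
  obtain ⟨a, ha⟩ := exists_isotropy_of_proj_eq hħ φ' φ hxy.symm
  exact Quotient.sound ⟨MulOpposite.op a, ha.symm⟩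

theorem range_cosetProj [FiniteDimensional ℂ H] {ħ : ℝ} (hħ : ħ ≠ 0) {ψ : H →L[ℂ] H}
    (hψ : IsUnit ψ) : range (cosetProj ħ ψ) = isospectralOrbit (proj ψ) := by
  ext σ
  constructor
  · rintro ⟨x, rfl⟩
    obtain ⟨φ, rfl⟩ := cosetMk_surjective ħ ψ x
    exact mapsTo_proj hħ hψ φ.2
  · rintro ⟨U, rfl⟩
    refine ⟨cosetMk ħ ψ ⟨_, unitary_mul_mem_levelSet hħ U.2 (self_mem_levelSet hψ)⟩, ?_⟩
    rw [cosetProj_mk]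
    simp only [proj, star_mul, mul_assoc]

/-- In finite dimension `φ†φ = ψ†ψ` already forces `φ` to be invertible, so the level set is closed;
the C*-identity gives `‖φ‖ = ‖ψ‖`. -/
theorem compactSpace_levelSet [FiniteDimensional ℂ H] {ħ : ℝ} (hħ : ħ ≠ 0) {ψ : H →L[ℂ] H}
    (hψ : IsUnit ψ) : CompactSpace (levelSet ħ ψ) := by
  have := finiteDimensional_real_operators (H := H)
  have := FiniteDimensional.proper_real (H →L[ℂ] H)
  have heq : levelSet ħ ψ = {φ | star φ * φ = star ψ * ψ} := by
    ext φ
    rw [mem_levelSet_iff hħ]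
    refine ⟨fun h => h.2, fun h => ⟨?_, h⟩⟩
    have h1 : IsUnit (star φ * φ) := by
      rw [h]
      exact hψ.star.mul hψ
    obtain ⟨v, hv⟩ := h1
    have h2 : ((↑v⁻¹ : H →L[ℂ] H) * star φ) * φ = 1 := by rw [mul_assoc, ← hv, Units.inv_mul]
    have h3 : (((↑v⁻¹ : H →L[ℂ] H) * star φ : H →L[ℂ] H) : H →ₗ[ℂ] H) * (φ : H →ₗ[ℂ] H) = 1 :=
      congrArg (fun A : H →L[ℂ] H => (A : H →ₗ[ℂ] H)) h2
    have h4 : φ * ((↑v⁻¹ : H →L[ℂ] H) * star φ) = 1 :=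
      ContinuousLinearMap.coe_injective (mul_eq_one_comm.1 h3)
    exact ⟨⟨φ, _, h4, h2⟩, rfl⟩
  rw [← isCompact_iff_compactSpace, heq]
  refine Metric.isCompact_of_isClosed_isBounded
    (isClosed_eq (continuous_star.mul continuous_id) continuous_const) ?_
  refine (Metric.isBounded_closedBall (x := (0 : H →L[ℂ] H)) (r := ‖ψ‖)).subset fun φ hφ => ?_
  rw [mem_closedBall_zero_iff]
  have h1 : ‖φ‖ * ‖φ‖ = ‖ψ‖ * ‖ψ‖ := by
    rw [← CStarRing.norm_star_mul_self, ← CStarRing.norm_star_mul_self, hφ]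
  exact (mul_self_inj (norm_nonneg _) (norm_nonneg _)).1 h1 |>.le

theorem contDiff_proj {n : WithTop ℕ∞} : ContDiff ℝ n (proj : (H →L[ℂ] H) → H →L[ℂ] H) :=
  contDiff_id.mul (starL' ℝ : (H →L[ℂ] H) ≃L[ℝ] (H →L[ℂ] H)).contDiff

/-- A continuous injection of a compact space into a Hausdorff space is an embedding; this
identifies the quotient topology with the subspace topology. -/
theorem isEmbedding_cosetProj [FiniteDimensional ℂ H] {ħ : ℝ} (hħ : ħ ≠ 0) {ψ : H →L[ℂ] H}
    (hψ : IsUnit ψ) : IsEmbedding (cosetProj ħ ψ) := by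
  have := compactSpace_levelSet hħ hψ
  have hc : Continuous (cosetProj ħ ψ) := continuous_quot_lift _
    ((contDiff_proj (n := 0)).continuous.comp continuous_subtype_val)
  exact (hc.isClosedEmbedding (cosetProj_injective hħ ψ)).isEmbedding

/-! ### The principal bundle -/

theorem contMDiffOn_mul_operators {EX HX X : Type*} [NormedAddCommGroup EX] [NormedSpace ℝ EX]
    [TopologicalSpace HX] {I : ModelWithCorners ℝ EX HX} [TopologicalSpace X] [ChartedSpace HX X]
    {f g : X → H →L[ℂ] H} {s : Set X} (hf : ContMDiffOn I 𝓘(ℝ, H →L[ℂ] H) ∞ f s)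
    (hg : ContMDiffOn I 𝓘(ℝ, H →L[ℂ] H) ∞ g s) :
    ContMDiffOn I 𝓘(ℝ, H →L[ℂ] H) ∞ (fun x => f x * g x) s :=
  (contDiff_mul (𝕜 := ℝ) (𝔸 := H →L[ℂ] H)).contMDiff.comp_contMDiffOn (hf.prodMk_space hg)

theorem contMDiffOn_star_operators {EX HX X : Type*} [NormedAddCommGroup EX] [NormedSpace ℝ EX]
    [TopologicalSpace HX] {I : ModelWithCorners ℝ EX HX} [TopologicalSpace X] [ChartedSpace HX X]
    {f : X → H →L[ℂ] H} {s : Set X} (hf : ContMDiffOn I 𝓘(ℝ, H →L[ℂ] H) ∞ f s) :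
    ContMDiffOn I 𝓘(ℝ, H →L[ℂ] H) ∞ (fun x => star (f x)) s :=
  (starL' ℝ : (H →L[ℂ] H) ≃L[ℝ] (H →L[ℂ] H)).contDiff.contMDiff.comp_contMDiffOn hf

theorem lieGroup_isotropyGroup {ħ : ℝ} {ψ : H →L[ℂ] H} {g : ℕ}
    [ChartedSpace (EuclideanSpace ℝ (Fin g)) (isotropyGroup ħ ψ)]
    [hG : IsManifold (𝓡 g) ∞ (isotropyGroup ħ ψ)]
    (hemb : Manifold.IsSmoothEmbedding (𝓡 g) 𝓘(ℝ, H →L[ℂ] H) ∞ (isotropyIncl ħ ψ)) :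
    LieGroup (𝓡 g) ∞ (isotropyGroup ħ ψ) where
  toIsManifold := hG
  contMDiff_mul := contMDiff_of_comp_smoothEmbedding hemb (contMDiffOn_univ.1
    (contMDiffOn_mul_operators (hemb.contMDiff.comp contMDiff_fst).contMDiffOn
      (hemb.contMDiff.comp contMDiff_snd).contMDiffOn))
  contMDiff_inv := contMDiff_of_comp_smoothEmbedding hemb (contMDiffOn_univ.1
    (contMDiffOn_star_operators hemb.contMDiff.contMDiffOn))

/-- The level set is a principal bundle over any embedded copy of the isospectral orbit. -/
theorem isPrincipalBundle_of_smoothEmbedding [FiniteDimensional ℂ H] {ħ : ℝ} (hħ : ħ ≠ 0)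
    {ψ : H →L[ℂ] H} (hψ : IsUnit ψ) {s g d : ℕ}
    [ChartedSpace (EuclideanSpace ℝ (Fin s)) (levelSet ħ ψ)]
    [ChartedSpace (EuclideanSpace ℝ (Fin g)) (isotropyGroup ħ ψ)]
    [IsManifold (𝓡 s) ∞ (levelSet ħ ψ)] [IsManifold (𝓡 g) ∞ (isotropyGroup ħ ψ)]
    (hS : Manifold.IsSmoothEmbedding (𝓡 s) 𝓘(ℝ, H →L[ℂ] H) ∞
      (Subtype.val : levelSet ħ ψ → H →L[ℂ] H))
    (hG : Manifold.IsSmoothEmbedding (𝓡 g) 𝓘(ℝ, H →L[ℂ] H) ∞ (isotropyIncl ħ ψ))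
    {N : Type*} [TopologicalSpace N] [ChartedSpace (EuclideanSpace ℝ (Fin d)) N]
    [hN : IsManifold (𝓡 d) ∞ N] {j : N → H →L[ℂ] H}
    (hj : Manifold.IsSmoothEmbedding (𝓡 d) 𝓘(ℝ, H →L[ℂ] H) ∞ j)
    (hrange : range j = isospectralOrbit (proj ψ)) {π : levelSet ħ ψ → N}
    (hπ : ∀ φ : levelSet ħ ψ, j (π φ) = proj (φ : H →L[ℂ] H)) :
    IsPrincipalBundle (𝓡 s) (𝓡 d) (𝓡 g) (isotropyGroup ħ ψ) π := by
  have hact : ContMDiff ((𝓡 s).prod (𝓡 g)) (𝓡 s) ∞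
      (fun x : levelSet ħ ψ × isotropyGroup ħ ψ => MulOpposite.op x.2 • x.1) :=
    contMDiff_of_comp_smoothEmbedding hS (contMDiffOn_univ.1
      (contMDiffOn_mul_operators (hS.contMDiff.comp contMDiff_fst).contMDiffOn
        (hG.contMDiff.comp contMDiff_snd).contMDiffOn))
  have hproj : ContMDiff (𝓡 s) (𝓡 d) ∞ π := by
    refine contMDiff_of_comp_smoothEmbedding hj ?_
    rw [show j ∘ π = proj ∘ Subtype.val from funext hπ]
    exact contDiff_proj.contMDiff.comp hS.contMDiff
  have hjinj : Function.Injective j := hj.isEmbedding.injective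
  have horb : ∀ (p : levelSet ħ ψ) (a : isotropyGroup ħ ψ), π (MulOpposite.op a • p) = π p := by
    intro p a
    apply hjinj
    rw [hπ, hπ]
    exact proj_mul_unitary (p : H →L[ℂ] H) a.1.2
  have hfiber : ∀ p p' : levelSet ħ ψ, π p = π p' ↔
      ∃ a : isotropyGroup ħ ψ, p' = MulOpposite.op a • p := by
    intro p p'
    constructor
    · intro h
      refine exists_isotropy_of_proj_eq hħ p p' ?_
      rw [← hπ, ← hπ, h]
    · rintro ⟨a, rfl⟩
      exact (horb p a).symm
  have hfree : ∀ (p : levelSet ħ ψ) (a : isotropyGroup ħ ψ), MulOpposite.op a • p = p → a = 1 := by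
    intro p a h
    have h1 : (p : H →L[ℂ] H) * isotropyIncl ħ ψ a = (p : H →L[ℂ] H) * 1 := by
      rw [mul_one]
      exact congrArg Subtype.val h
    exact Subtype.ext (Subtype.ext (p.2.1.mul_left_cancel h1))
  have hcover : ∀ x : N, ∃ (V : Set N) (sec : N → levelSet ħ ψ), IsOpen V ∧ x ∈ V ∧
      ContMDiffOn (𝓡 d) (𝓡 s) ∞ sec V ∧ ∀ n ∈ V, π (sec n) = n := by
    intro x
    obtain ⟨O, U, hO, hxO, hU, hUy⟩ := exists_unitary_intertwiner (ρ := proj ψ)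
      (IsSelfAdjoint.mul_star_self ψ) (x := j x) (by rw [← hrange]; exact ⟨x, rfl⟩)
    have hmem : ∀ n ∈ j ⁻¹' O, U (j n) * ψ ∈ levelSet ħ ψ := fun n hn =>
      unitary_mul_mem_levelSet hħ (hUy _ hn).1 (self_mem_levelSet hψ)
    classical
    let sec : N → levelSet ħ ψ := fun n =>
      if hn : n ∈ j ⁻¹' O then ⟨U (j n) * ψ, hmem n hn⟩ else ⟨ψ, self_mem_levelSet hψ⟩
    have hsec : ∀ n ∈ j ⁻¹' O, (sec n : H →L[ℂ] H) = U (j n) * ψ := fun n hn => by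
      simp only [sec, dif_pos hn]
    refine ⟨j ⁻¹' O, sec, hO.preimage hj.isEmbedding.continuous, hxO, ?_, ?_⟩
    · refine contMDiffOn_of_comp_smoothEmbedding hS
        (hO.preimage hj.isEmbedding.continuous) (ContMDiffOn.congr ?_ hsec)
      exact contMDiffOn_mul_operators
        (hU.contMDiffOn.comp hj.contMDiff.contMDiffOn fun _ h => h) contMDiffOn_const
    · intro n hn
      apply hjinj
      rw [hπ, hsec n hn]
      have h1 := (hUy _ hn).2 (by rw [← hrange]; exact ⟨n, rfl⟩)
      refine Eq.trans ?_ h1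
      simp only [proj, star_mul, mul_assoc]
  have hsurj : Function.Surjective π := fun x => by
    obtain ⟨V, sec, -, hxV, -, h⟩ := hcover x
    exact ⟨sec x, h x hxV⟩
  refine ⟨inferInstance, hN, lieGroup_isotropyGroup hG, hact, hproj, hfree, hsurj, hfiber, ?_⟩
  intro x
  obtain ⟨V, sec, hV, hxV, hsec, hsec'⟩ := hcover x
  have hex : ∀ p : levelSet ħ ψ, ∃ a : isotropyGroup ħ ψ, π p ∈ V →
      p = MulOpposite.op a • sec (π p) := by
    intro p
    by_cases hp : π p ∈ V
    · obtain ⟨a, ha⟩ := (hfiber (sec (π p)) p).1 (hsec' _ hp)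
      exact ⟨a, fun _ => ha⟩
    · exact ⟨1, fun h => absurd h hp⟩
  choose τ hτ using hex
  -- From `p = sec(π p) τ(p)` and `sec† sec = ψ†ψ` follows `τ(p) = (ψ†ψ)⁻¹ sec(π p)† p`, which is
  -- visibly smooth.
  have hτs : ContMDiffOn (𝓡 s) (𝓡 g) ∞ τ (π ⁻¹' V) := by
    refine contMDiffOn_of_comp_smoothEmbedding hG (hV.preimage hproj.continuous) ?_
    have hsp : ContMDiffOn (𝓡 s) 𝓘(ℝ, H →L[ℂ] H) ∞
        (fun p => (sec (π p) : H →L[ℂ] H)) (π ⁻¹' V) :=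
      hS.contMDiff.comp_contMDiffOn (hsec.comp hproj.contMDiffOn fun _ h => h)
    obtain ⟨v, hv⟩ := hψ.star.mul hψ
    refine (contMDiffOn_mul_operators (contMDiffOn_const (c := (↑v⁻¹ : H →L[ℂ] H)))
      (contMDiffOn_mul_operators (contMDiffOn_star_operators hsp)
        hS.contMDiff.contMDiffOn)).congr fun p hp => ?_
    have h1 : (p : H →L[ℂ] H) = (sec (π p) : H →L[ℂ] H) * isotropyIncl ħ ψ (τ p) :=
      congrArg Subtype.val (hτ p hp)
    have h2 := ((mem_levelSet_iff hħ _ ψ).1 (sec (π p)).2).2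
    rw [← hv] at h2
    change isotropyIncl ħ ψ (τ p) = ↑v⁻¹ * (star (sec (π p) : H →L[ℂ] H) * (p : H →L[ℂ] H))
    conv_rhs => enter [2, 2]; rw [h1]
    rw [← mul_assoc (star _), h2, ← mul_assoc, Units.inv_mul, one_mul]
  obtain ⟨e, he, h⟩ := exists_trivialization_of_section hproj hact hfree horb hV hsec hsec' hτs
    fun p hp => (hτ p hp).symm
  exact ⟨e, by rwa [he], h⟩

/-- The standard smooth structures exist. -/
theorem exists_isStandardSmoothStructure [FiniteDimensional ℂ H] {ħ : ℝ} (hħ : ħ ≠ 0)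
    {ψ : H →L[ℂ] H} (hψ : IsUnit ψ) :
    ∃ (s g d q : ℕ) (_ : ChartedSpace (EuclideanSpace ℝ (Fin s)) (levelSet ħ ψ))
      (_ : ChartedSpace (EuclideanSpace ℝ (Fin g)) (isotropyGroup ħ ψ))
      (_ : ChartedSpace (EuclideanSpace ℝ (Fin d)) (isospectralOrbit (proj ψ)))
      (_ : ChartedSpace (EuclideanSpace ℝ (Fin q)) (cosetSpace ħ ψ)),
      IsStandardSmoothStructure ħ ψ (proj ψ) s g d q := by
  have hρ : IsSelfAdjoint (proj ψ) := IsSelfAdjoint.mul_star_self ψ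
  obtain ⟨s, cs, ms, es⟩ := exists_manifold_levelSet hħ hψ
  obtain ⟨g, cg, mg, eg⟩ := exists_manifold_isotropyGroup hħ ψ
  obtain ⟨d, cd, md, ed⟩ := exists_manifold_of_range_eq_isospectralOrbit hρ
    (IsEmbedding.subtypeVal (p := (· ∈ isospectralOrbit (proj ψ)))) Subtype.range_coe
  -- The coset space receives its structure as an embedded copy of the orbit, and the bundle theorem
  -- over this copy makes the quotient map a submersion.
  obtain ⟨q, cq, mq, eq⟩ := exists_manifold_of_range_eq_isospectralOrbit hρ
    (isEmbedding_cosetProj hħ hψ) (range_cosetProj hħ hψ)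
  have hb := isPrincipalBundle_of_smoothEmbedding hħ hψ es eg eq (range_cosetProj hħ hψ)
    (π := cosetMk ħ ψ) cosetProj_mk
  refine ⟨s, g, d, q, cs, cg, cd, cq, ms, mg, md, mq, es, eg, ed,
    isSubmersion_of_locallyTrivial (EG := EuclideanSpace ℝ (Fin g))
      (G := isotropyGroup ħ ψ) fun x => ?_⟩
  obtain ⟨e, hx, h1, h2, -⟩ := hb.locallyTrivial x
  exact ⟨e, hx, h1, h2⟩

/-- The coset space is diffeomorphic to the isospectral orbit. -/
theorem exists_diffeomorph_cosetSpace [FiniteDimensional ℂ H] {ħ : ℝ} (hħ : ħ ≠ 0)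
    {ψ ρ : H →L[ℂ] H} {s g d q : ℕ}
    [ChartedSpace (EuclideanSpace ℝ (Fin s)) (levelSet ħ ψ)]
    [ChartedSpace (EuclideanSpace ℝ (Fin g)) (isotropyGroup ħ ψ)]
    [ChartedSpace (EuclideanSpace ℝ (Fin d)) (isospectralOrbit ρ)]
    [ChartedSpace (EuclideanSpace ℝ (Fin q)) (cosetSpace ħ ψ)]
    (hstd : IsStandardSmoothStructure ħ ψ ρ s g d q) {π : levelSet ħ ψ → isospectralOrbit ρ}
    (hπ : ∀ φ, (π φ : H →L[ℂ] H) = proj (φ : H →L[ℂ] H))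
    (hb : IsPrincipalBundle (𝓡 s) (𝓡 d) (𝓡 g) (isotropyGroup ħ ψ) π) :
    ∃ Φ : Diffeomorph (𝓡 q) (𝓡 d) (cosetSpace ħ ψ) (isospectralOrbit ρ) ∞,
      ∀ φ, Φ (cosetMk ħ ψ φ) = π φ := by
  have hmem : ∀ x, cosetProj ħ ψ x ∈ isospectralOrbit ρ := fun x => by
    obtain ⟨φ, rfl⟩ := cosetMk_surjective ħ ψ x
    rw [cosetProj_mk, ← hπ]
    exact (π φ).2
  let f : cosetSpace ħ ψ → isospectralOrbit ρ := fun x => ⟨cosetProj ħ ψ x, hmem x⟩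
  have hf : ∀ φ, f (cosetMk ħ ψ φ) = π φ := fun φ => Subtype.ext (hπ φ).symm
  have hbij : Function.Bijective f := by
    constructor
    · exact fun x y h => cosetProj_injective hħ ψ (congrArg Subtype.val h)
    · intro y
      obtain ⟨φ, rfl⟩ := hb.surjective y
      exact ⟨_, hf φ⟩
  have hfs : ContMDiff (𝓡 q) (𝓡 d) ∞ f := by
    refine contMDiff_of_comp_submersion hstd.submersion_cosetMk (cosetMk_surjective ħ ψ) ?_
    rw [show f ∘ cosetMk ħ ψ = π from funext hf]
    exact hb.contMDiff_proj
  have hmk : ContMDiff (𝓡 s) (𝓡 q) ∞ (cosetMk ħ ψ) := hstd.submersion_cosetMk.contMDiff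
  let F := Equiv.ofBijective f hbij
  refine ⟨⟨F, hfs, fun y => ?_⟩, hf⟩
  obtain ⟨e, hy, -, he, -⟩ := hb.locallyTrivial y
  -- Locally the inverse is the class of the section `z ↦ e⁻¹(z, 1)`.
  have hloc : ContMDiffOn (𝓡 d) (𝓡 q) ∞
      (fun z => cosetMk ħ ψ (e.toOpenPartialHomeomorph.symm (z, 1))) e.baseSet :=
    hmk.comp_contMDiffOn (he.comp (contMDiffOn_id.prodMk contMDiffOn_const) fun z hz =>
      e.mem_target.2 hz)
  refine (hloc.contMDiffAt (e.open_baseSet.mem_nhds hy)).congr_of_eventuallyEq ?_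
  filter_upwards [e.open_baseSet.mem_nhds hy] with z hz
  refine F.symm_apply_eq.2 ?_
  change z = f _
  rw [hf]
  exact (e.proj_symm_apply (x := (z, 1)) (e.mem_target.2 hz)).symm

end Bundle

end Purification

theorem mainTheorem5 {H : Type*} [NormedAddCommGroup H] [InnerProductSpace ℂ H] [CompleteSpace H]
    [FiniteDimensional ℂ H] (ħ : ℝ) (hħ : 0 < ħ) (ρ ψ : H →L[ℂ] H)
    (hψ : Purification.Purifies ψ ρ) :
    -- `U(ψ)` is the group of unitaries commuting with `ψ† ψ`
    (∀ U : unitary (H →L[ℂ] H), U ∈ Purification.isotropyGroup ħ ψ ↔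
      (U : H →L[ℂ] H) * (star ψ * ψ) = (star ψ * ψ) * (U : H →L[ℂ] H)) ∧
    -- the standard smooth structures exist
    (∃ (s g d q : ℕ)
      (_ : ChartedSpace (EuclideanSpace ℝ (Fin s)) (Purification.levelSet ħ ψ))
      (_ : ChartedSpace (EuclideanSpace ℝ (Fin g)) (Purification.isotropyGroup ħ ψ))
      (_ : ChartedSpace (EuclideanSpace ℝ (Fin d)) (Purification.isospectralOrbit ρ))
      (_ : ChartedSpace (EuclideanSpace ℝ (Fin q)) (Purification.cosetSpace ħ ψ)),
      Purification.IsStandardSmoothStructure ħ ψ ρ s g d q) ∧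
    -- for them, `[φ] ↦ φ φ†` is a diffeomorphism and `φ ↦ φ φ†` is a principal bundle
    ∀ (s g d q : ℕ)
      [ChartedSpace (EuclideanSpace ℝ (Fin s)) (Purification.levelSet ħ ψ)]
      [ChartedSpace (EuclideanSpace ℝ (Fin g)) (Purification.isotropyGroup ħ ψ)]
      [ChartedSpace (EuclideanSpace ℝ (Fin d)) (Purification.isospectralOrbit ρ)]
      [ChartedSpace (EuclideanSpace ℝ (Fin q)) (Purification.cosetSpace ħ ψ)],
      Purification.IsStandardSmoothStructure ħ ψ ρ s g d q →
      ∃ hmaps : Set.MapsTo Purification.proj (Purification.levelSet ħ ψ)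
          (Purification.isospectralOrbit ρ),
        (∃ Φ : Diffeomorph (𝓡 q) (𝓡 d) (Purification.cosetSpace ħ ψ)
            (Purification.isospectralOrbit ρ) ∞,
          ∀ φ : Purification.levelSet ħ ψ,
            Φ (Purification.cosetMk ħ ψ φ) = hmaps.restrict Purification.proj _ _ φ) ∧
        Purification.IsPrincipalBundle (𝓡 s) (𝓡 d) (𝓡 g) (Purification.isotropyGroup ħ ψ)
          (hmaps.restrict Purification.proj (Purification.levelSet ħ ψ)
            (Purification.isospectralOrbit ρ)) := by
  obtain ⟨-, ⟨hu, -⟩, rfl⟩ := hψ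
  refine ⟨Purification.mem_isotropyGroup_iff hħ.ne' ψ,
    Purification.exists_isStandardSmoothStructure hħ.ne' hu, ?_⟩
  intro s g d q _ _ _ _ hstd
  have := hstd.isManifold_levelSet
  have := hstd.isManifold_isotropyGroup
  have := hstd.isManifold_isospectralOrbit
  have hmaps := Purification.mapsTo_proj hħ.ne' hu
  have hb := Purification.isPrincipalBundle_of_smoothEmbedding hħ.ne' hu hstd.embedding_levelSet
    hstd.embedding_isotropyGroup hstd.embedding_isospectralOrbit Subtype.range_coe
    (π := hmaps.restrict Purification.proj _ _) fun _ => rfl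
  exact ⟨hmaps, Purification.exists_diffeomorph_cosetSpace hħ.ne' hstd (fun _ => rfl) hb, hb⟩
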